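/- **Theorem.** Let $K$ be an algebraically closed field and let $\Lambda$ be a connected finite dimensional gentle $K$-algebra. Suppose that, for some integer $d \geq 2$, the category $\operatorname{mod} \Lambda$ of finitely generated right $\Lambda$-modules contains a $d$-cluster tilting subcategory. Then $\Lambda$ is a radical square zero Nakayama algebra; that is, as a $K$-algebra, $\Lambda$ is isomorphic to $KA_n/J^2$ for some $n \geq 1$ or to $K\widetilde{A}_n/J^2$ for some $n \geq 0$. Here $A_n$ is the linearly oriented quiver $1 \to 2 \to \cdots \to n$, $\widetilde{A}_n$ is the cyclically oriented quiver $0 \to 1 \to \cdots \to n \to 0$ (a single loop if $n = 0$), and $J$ is the arrow ideal, i.e. the two-sided ideal generated by the arrows. Definitions. The product $\alpha\beta$ of arrows in a path algebra $KQ$ is the path "first $\alpha$, then $\beta$", defined when $\alpha$ ends where $\beta$ starts. A $K$-algebra is *gentle* if it is isomorphic to $KQ/I$, where $Q$ is a finite quiver and $I$ is a two-sided ideal of $KQ$ such that: for every arrow $\alpha$ there is at most one arrow $\beta$ starting where $\alpha$ ends with $\alpha\beta \notin I$ and at most one with $\alpha\beta \in I$; for every arrow $\alpha$ there is at most one arrow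 $\gamma$ ending where $\alpha$ starts with $\gamma\alpha \notin I$ and at most one with $\gamma\alpha \in I$; the ideal $I$ is admissible ($J^m \subseteq I \subseteq J^2$ for some $m$); and $I$ is generated by the paths of length two that it contains. An algebra is *connected* if it is nonzero and its only central idempotents are $0$ and $1$. A full subcategory $\mathcal{U}$ of an abelian category $\mathcal{C}$ is *$d$-cluster tilting* if it is functorially finite (every object of $\mathcal{C}$ has a right and a left $\mathcal{U}$-approximation), generating and cogenerating (every object of $\mathcal{C}$ is a quotient of an object of $\mathcal{U}$ and embeds into an object of $\mathcal{U}$), and $$\mathcal{U} = \{X \in \mathcal{C} \mid \operatorname{Ext}^i_{\mathcal{C}}(\mathcal{U}, X) = 0 \text{ for } 1 \leq i \leq d-1\} = \{X \in \mathcal{C} \mid \operatorname{Ext}^i_{\mathcal{C}}(X, \mathcal{U}) = 0 \text{ for } 1 \leq i \leq d-1\}.$$ -/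

import Mathlib

open CategoryTheory

universe u v w uQ vQ

noncomputable section

/-! ## Path algebras of finite quivers -/

/-- The type of all paths (including the trivial ones) of a quiver `Q`. -/
abbrev QuiverPath (Q : Type*) [Quiver Q] := Σ x y : Q, Quiver.Path x y

/-- The path algebra `K Q`: the `K`-vector space with basis the paths of `Q`. -/
def PathAlgebra (K Q : Type*) [Field K] [Quiver Q] := QuiverPath Q →₀ K

namespace PathAlgebra

section

variable {K Q : Type*} [Field K] [Quiver Q]

instance : AddCommGroup (PathAlgebra K Q) := inferInstanceAs (AddCommGroup (QuiverPath Q →₀ K))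

instance : Module K (PathAlgebra K Q) := inferInstanceAs (Module K (QuiverPath Q →₀ K))

variable (K) in
/-- The basis element of `K Q` given by a path. -/
def ofPath {x y : Q} (p : Quiver.Path x y) : PathAlgebra K Q :=
  (Finsupp.single (⟨x, y, p⟩ : QuiverPath Q) (1 : K) : QuiverPath Q →₀ K)

open Classical in
variable (K) in
/-- The product of two basis elements: concatenation `p q` (first `p`, then `q`) if `p` ends
where `q` starts, and zero otherwise. -/
def mulPath (p q : QuiverPath Q) : PathAlgebra K Q :=
  if h : p.2.1 = q.1 then ofPath K (p.2.2.comp (q.2.2.cast h.symm rfl)) else 0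

variable (K Q) in
/-- The bilinear extension of `mulPath`. -/
def mulLin : PathAlgebra K Q →ₗ[K] PathAlgebra K Q →ₗ[K] PathAlgebra K Q :=
  Finsupp.linearCombination K fun p : QuiverPath Q =>
    (Finsupp.linearCombination K fun q : QuiverPath Q => mulPath K p q :
      (QuiverPath Q →₀ K) →ₗ[K] PathAlgebra K Q)

instance : Mul (PathAlgebra K Q) := ⟨fun a b => mulLin K Q a b⟩

theorem mul_def (a b : PathAlgebra K Q) : a * b = mulLin K Q a b := rfl

theorem mulLin_ofPath {x y z w : Q} (p : Quiver.Path x y) (q : Quiver.Path z w) :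
    mulLin K Q (ofPath K p) (ofPath K q) = mulPath K ⟨x, y, p⟩ ⟨z, w, q⟩ := by
  unfold mulLin ofPath
  erw [Finsupp.linearCombination_single, one_smul, Finsupp.linearCombination_single, one_smul]

theorem ofPath_mul_ofPath {x y z : Q} (p : Quiver.Path x y) (q : Quiver.Path y z) :
    ofPath K p * ofPath K q = ofPath K (p.comp q) := by
  rw [mul_def, mulLin_ofPath]; simp [mulPath]

theorem ofPath_mul_ofPath_of_ne {x y z w : Q} (p : Quiver.Path x y) (q : Quiver.Path z w)
    (h : y ≠ z) : ofPath K p * ofPath K q = 0 := by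
  rw [mul_def, mulLin_ofPath]; simp [mulPath, h]

@[elab_as_elim]
theorem induction {P : PathAlgebra K Q → Prop} (a : PathAlgebra K Q) (h0 : P 0)
    (hadd : ∀ a b, P a → P b → P (a + b))
    (hsmul : ∀ (c : K) {x y : Q} (p : Quiver.Path x y), P (c • ofPath K p)) : P a := by
  refine Finsupp.induction_linear (motive := P) a h0 hadd ?_
  rintro ⟨x, y, p⟩ c
  have := hsmul c p
  unfold ofPath at this
  erw [Finsupp.smul_single, smul_eq_mul, mul_one] at this
  exact this

theorem smul_mul' (c : K) (a b : PathAlgebra K Q) : (c • a) * b = c • (a * b) := by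
  simp [mul_def]

theorem mul_smul' (c : K) (a b : PathAlgebra K Q) : a * (c • b) = c • (a * b) := by
  simp [mul_def]

theorem add_mul' (a b c : PathAlgebra K Q) : (a + b) * c = a * c + b * c := by
  simp [mul_def]

theorem mul_add' (a b c : PathAlgebra K Q) : a * (b + c) = a * b + a * c := by
  simp [mul_def]

theorem zero_mul' (a : PathAlgebra K Q) : 0 * a = 0 := by
  simp [mul_def]

theorem mul_zero' (a : PathAlgebra K Q) : a * 0 = 0 := by
  simp [mul_def]

theorem mul_assoc' (a b c : PathAlgebra K Q) : a * b * c = a * (b * c) := by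
  induction a using induction with
  | h0 => simp [zero_mul']
  | hadd a a' h h' => simp [add_mul', h, h']
  | hsmul r p =>
    induction b using induction with
    | h0 => simp [zero_mul', mul_zero']
    | hadd b b' h h' => simp [add_mul', mul_add', h, h']
    | hsmul s q =>
      induction c using induction with
      | h0 => simp [mul_zero']
      | hadd c c' h h' => simp [mul_add', h, h']
      | hsmul t u =>
        rename_i x y z w v v'
        simp only [smul_mul', mul_smul']
        congr 3
        by_cases h1 : y = z
        · subst h1
          by_cases h2 : w = v
          · subst h2
            simp [ofPath_mul_ofPath]
          · simp [ofPath_mul_ofPath, ofPath_mul_ofPath_of_ne, h2, mul_zero']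
        · by_cases h2 : w = v
          · subst h2
            simp [ofPath_mul_ofPath, ofPath_mul_ofPath_of_ne, h1, zero_mul']
          · simp [ofPath_mul_ofPath_of_ne, h1, h2, zero_mul', mul_zero']

variable [Fintype Q]

/-- The unit is the sum of the trivial paths. -/
instance instOnePathAlgebra : One (PathAlgebra K Q) := ⟨∑ x : Q, ofPath K (Quiver.Path.nil : Quiver.Path x x)⟩

theorem one_def :
    (1 : PathAlgebra K Q) = ∑ x : Q, ofPath K (Quiver.Path.nil : Quiver.Path x x) := rfl

theorem one_mul' (a : PathAlgebra K Q) : 1 * a = a := by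
  induction a using induction with
  | h0 => exact mul_zero' _
  | hadd a b h h' => rw [mul_add', h, h']
  | hsmul c p =>
    rename_i x y
    rw [mul_smul', one_def, mul_def, map_sum, LinearMap.sum_apply, Finset.sum_eq_single x]
    · rw [← mul_def, ofPath_mul_ofPath, Quiver.Path.nil_comp]
    · intro z _ hz
      rw [← mul_def, ofPath_mul_ofPath_of_ne _ _ hz]
    · simp

theorem mul_one' (a : PathAlgebra K Q) : a * 1 = a := by
  induction a using induction with
  | h0 => exact zero_mul' _
  | hadd a b h h' => rw [add_mul', h, h']
  | hsmul c p =>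
    rename_i x y
    rw [smul_mul', one_def, mul_def, map_sum, Finset.sum_eq_single y]
    · rw [← mul_def, ofPath_mul_ofPath, Quiver.Path.comp_nil]
    · intro z _ hz
      rw [← mul_def, ofPath_mul_ofPath_of_ne _ _ hz.symm]
    · simp

instance : Ring (PathAlgebra K Q) :=
  { (inferInstance : AddCommGroup (PathAlgebra K Q)) with
    mul := (· * ·)
    one := 1
    left_distrib := mul_add'
    right_distrib := add_mul'
    zero_mul := zero_mul'
    mul_zero := mul_zero'
    mul_assoc := mul_assoc'
    one_mul := one_mul'
    mul_one := mul_one' }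

instance : Algebra K (PathAlgebra K Q) := Algebra.ofModule smul_mul' mul_smul'

end

variable (K Q : Type*) [Field K] [Quiver Q] [Fintype Q]

/-- The power `J ^ m` of the arrow ideal `J` of `K Q`, that is, the two-sided ideal generated by
the paths of length `m`. -/
def arrowIdealPow (m : ℕ) : TwoSidedIdeal (PathAlgebra K Q) :=
  TwoSidedIdeal.span {a | ∃ (x y : Q) (p : Quiver.Path x y), p.length = m ∧ a = ofPath K p}

end PathAlgebra

/-! ## Gentle algebras -/

section Gentle

variable {K Q : Type*} [Field K] [Quiver Q] [Fintype Q]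

/-- The product `α β` in `K Q` of two composable arrows. -/
def arrowMul (K : Type*) [Field K] {x y z : Q} (α : x ⟶ y) (β : y ⟶ z) : PathAlgebra K Q :=
  PathAlgebra.ofPath K (α.toPath.comp β.toPath)

/-- An ideal `I` of `K Q` is admissible if `J ^ m ⊆ I ⊆ J ^ 2` for some `m`. -/
def IsAdmissible (I : TwoSidedIdeal (PathAlgebra K Q)) : Prop :=
  I ≤ PathAlgebra.arrowIdealPow K Q 2 ∧ ∃ m : ℕ, PathAlgebra.arrowIdealPow K Q m ≤ I

/-- The conditions on `(Q, I)` under which `K Q / I` is gentle (the finiteness of the set of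
vertices is the ambient `Fintype Q`). `Quiver.Star y` is the type of arrows starting in `y` and
`Quiver.Costar x` is the type of arrows ending in `x`. -/
structure IsGentlePresentation (I : TwoSidedIdeal (PathAlgebra K Q)) : Prop where
  finite_arrows : ∀ x y : Q, Finite (x ⟶ y)
  right_nonzero : ∀ {x y : Q} (α : x ⟶ y),
    {β : Quiver.Star y | arrowMul K α β.2 ∉ I}.Subsingleton
  left_nonzero : ∀ {x y : Q} (α : x ⟶ y),
    {γ : Quiver.Costar x | arrowMul K γ.2 α ∉ I}.Subsingleton
  right_zero : ∀ {x y : Q} (α : x ⟶ y),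
    {β : Quiver.Star y | arrowMul K α β.2 ∈ I}.Subsingleton
  left_zero : ∀ {x y : Q} (α : x ⟶ y),
    {γ : Quiver.Costar x | arrowMul K γ.2 α ∈ I}.Subsingleton
  admissible : IsAdmissible I
  generated : I = TwoSidedIdeal.span
    {a | a ∈ I ∧ ∃ (x y z : Q) (α : x ⟶ y) (β : y ⟶ z), a = arrowMul K α β}

end Gentle

/-- A `K`-algebra is gentle if it is of the form `K Q / I` with `(Q, I)` as above. -/
def IsGentleAlgebra (K : Type u) (Λ : Type w) [Field K] [Ring Λ] [Algebra K Λ] : Prop :=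
  ∃ (Q : Type uQ) (_ : Quiver.{vQ} Q) (_ : Fintype Q) (I : TwoSidedIdeal (PathAlgebra K Q)),
    IsGentlePresentation I ∧ Nonempty (Λ ≃ₐ[K] I.ringCon.Quotient)

/-- A ring is connected if it is nonzero and is not a product of two nonzero rings, that is, it has
no central idempotents other than `0` and `1 ≠ 0`. -/
def IsConnectedRing (Λ : Type*) [Ring Λ] : Prop :=
  Nontrivial Λ ∧ ∀ e ∈ Subring.center Λ, e * e = e → e = 0 ∨ e = 1

/-! ## Radical square zero Nakayama algebras -/

/-- The set of vertices of the linear quiver with `n` vertices. -/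
def LinearQuiver (n : ℕ) : Type := Fin n

instance (n : ℕ) : Fintype (LinearQuiver n) := inferInstanceAs (Fintype (Fin n))

/-- The linearly oriented quiver `A_n`: one arrow from each vertex to its successor. -/
instance (n : ℕ) : Quiver.{0} (LinearQuiver n) :=
  ⟨fun i j => PLift ((show Fin n from i).val + 1 = (show Fin n from j).val)⟩

/-- The set of vertices of the cyclic quiver with vertices `0, …, n`. -/
def CyclicQuiver (n : ℕ) : Type := Fin (n + 1)

instance (n : ℕ) : Fintype (CyclicQuiver n) := inferInstanceAs (Fintype (Fin (n + 1)))

/-- The cyclically oriented quiver with vertices `0, …, n`: one arrow from each vertex to its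
successor modulo `n + 1` (a loop if `n = 0`). -/
instance (n : ℕ) : Quiver.{0} (CyclicQuiver n) :=
  ⟨fun i j => PLift (((show Fin (n + 1) from i).val + 1) % (n + 1) =
    (show Fin (n + 1) from j).val)⟩

/-- `K Q / J ^ 2`, where `J` is the arrow ideal. -/
abbrev RadSqZeroPathAlgebra (K Q : Type*) [Field K] [Quiver Q] [Fintype Q] :=
  (PathAlgebra.arrowIdealPow K Q 2).ringCon.Quotient

/-- A `K`-algebra is a radical square zero Nakayama algebra if it is the path algebra of a linearly
oriented or of a cyclically oriented quiver modulo the square of the arrow ideal. -/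
def IsRadSqZeroNakayama (K : Type*) (Λ : Type*) [Field K] [Ring Λ] [Algebra K Λ] : Prop :=
  (∃ n : ℕ, 1 ≤ n ∧ Nonempty (Λ ≃ₐ[K] RadSqZeroPathAlgebra K (LinearQuiver n))) ∨
    ∃ n : ℕ, Nonempty (Λ ≃ₐ[K] RadSqZeroPathAlgebra K (CyclicQuiver n))

/-! ## `d`-cluster tilting subcategories -/

section ClusterTilting

variable {C : Type u} [Category.{v} C]

/-- Every object has a right approximation by an object of the full subcategory `U`. -/
def IsContravariantlyFinite (U : ObjectProperty C) : Prop :=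
  ∀ X : C, ∃ (Y : C) (_ : U Y) (f : Y ⟶ X), ∀ (Y' : C), U Y' → ∀ g : Y' ⟶ X, ∃ h, h ≫ f = g

/-- Every object has a left approximation by an object of the full subcategory `U`. -/
def IsCovariantlyFinite (U : ObjectProperty C) : Prop :=
  ∀ X : C, ∃ (Y : C) (_ : U Y) (f : X ⟶ Y), ∀ (Y' : C), U Y' → ∀ g : X ⟶ Y', ∃ h, f ≫ h = g

variable [Abelian C] [HasExt.{w} C]

/-- The objects `X` with `Ext ^ i (U, X) = 0` for `1 ≤ i ≤ d - 1`. -/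
def extRightPerp (U : ObjectProperty C) (d : ℕ) : ObjectProperty C := fun X =>
  ∀ Y : C, U Y → ∀ i : ℕ, 1 ≤ i → i < d → Subsingleton (Abelian.Ext.{w} Y X i)

/-- The objects `X` with `Ext ^ i (X, U) = 0` for `1 ≤ i ≤ d - 1`. -/
def extLeftPerp (U : ObjectProperty C) (d : ℕ) : ObjectProperty C := fun X =>
  ∀ Y : C, U Y → ∀ i : ℕ, 1 ≤ i → i < d → Subsingleton (Abelian.Ext.{w} X Y i)

/-- `d`-cluster tilting (full) subcategories of an abelian category. -/
structure IsDClusterTilting (d : ℕ) (U : ObjectProperty C) : Prop where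
  contravariantlyFinite : IsContravariantlyFinite U
  covariantlyFinite : IsCovariantlyFinite U
  generating : ∀ X : C, ∃ (Y : C) (_ : U Y) (f : Y ⟶ X), Epi f
  cogenerating : ∀ X : C, ∃ (Y : C) (_ : U Y) (f : X ⟶ Y), Mono f
  eq_rightPerp : U = extRightPerp.{u, v, w} U d
  eq_leftPerp : U = extLeftPerp.{u, v, w} U d

end ClusterTilting

theorem isNoetherianRing_mulOpposite (K : Type u) (Λ : Type w) [Field K] [Ring Λ] [Algebra K Λ]
    [Module.Finite K Λ] : IsNoetherianRing Λᵐᵒᵖ :=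
  have : Module.Finite K Λᵐᵒᵖ := Module.Finite.equiv (MulOpposite.opLinearEquiv K (M := Λ))
  isNoetherian_of_tower K inferInstance

/-- The category of finitely generated right modules over the finite dimensional `K`-algebra `Λ`
(right `Λ`-modules are `Λᵐᵒᵖ`-modules) contains a `d`-cluster tilting subcategory. -/
def HasDClusterTiltingSubcategory (K : Type u) (Λ : Type w) [Field K] [Ring Λ] [Algebra K Λ]
    [Module.Finite K Λ] (d : ℕ) : Prop :=
  haveI : IsNoetherianRing Λᵐᵒᵖ := isNoetherianRing_mulOpposite K Λ
  haveI : HasExt.{w + 1} (FGModuleCat.{w} Λᵐᵒᵖ) := HasExt.standard _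
  ∃ U : ObjectProperty (FGModuleCat.{w} Λᵐᵒᵖ), IsDClusterTilting.{w + 1, w, w + 1} d U

end

/-! Only one consequence of cluster tilting is needed. Injectives and projectives both lie in a
`d`-cluster tilting subcategory, so Ext¹ of an injective by a projective vanishes when `d ≥ 2`; in
particular Ext¹(DΛ, Λ) = 0, where DΛ is the `K`-dual of Λ.

An extension of DΛ by Λ can be given by a derivation θ of Λ with values in Hom_K(DΛ, Λ), and a
splitting writes θ as inner: θ(a)(f) = h(fa) - h(f)a. Many derivations are available on Λ = KQ/I.
For weights F, G on the arrows, put θ(α)(f) = G(α) f(e_x) α - F(α) f(α) e_y for α : x ⟶ y. This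
respects a relation αβ ∈ I as soon as G(β) = F(α). Innerness, tested on the coefficient functionals
of e_x and of α, forces G(α) = c(x) and F(α) = c(y) for a single function c on vertices
(`exists_vertex_weight`).

For a gentle presentation this rigidity is decisive. Take G to be the indicator of an arrow β
starting at v, and F the indicator of the arrows α with αβ ∈ I. Then c(v) = 1, so β is the only
arrow leaving v and every arrow into v composes with β to a relation (`star_eq_and_arrowMul_mem`).
Hence I = J², and a similar choice of weights shows that at most one arrow enters each vertex. A
connected finite quiver of this kind is a line or a cycle (`exists_enumeration`). -/

noncomputable section

/-! ### Extensions of injectives by projectives split -/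

section Splitting

variable {R : Type w} [Ring R] [IsNoetherianRing R]

theorem FGModuleCat.mono_iff_injective {X Y : FGModuleCat.{w} R} (f : X ⟶ Y) :
    Mono f ↔ Function.Injective f.hom.hom := by
  constructor
  · intro hf
    have : Mono ((forget₂ (FGModuleCat.{w} R) (ModuleCat.{w} R)).map f) := inferInstance
    exact (ModuleCat.mono_iff_injective _).1 this
  · intro hf
    have : Mono ((forget₂ (FGModuleCat.{w} R) (ModuleCat.{w} R)).map f) :=
      (ModuleCat.mono_iff_injective _).2 hf
    exact (forget₂ (FGModuleCat.{w} R) (ModuleCat.{w} R)).mono_of_mono_map this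

theorem FGModuleCat.epi_iff_surjective {X Y : FGModuleCat.{w} R} (f : X ⟶ Y) :
    Epi f ↔ Function.Surjective f.hom.hom := by
  constructor
  · intro hf
    have : Epi ((forget₂ (FGModuleCat.{w} R) (ModuleCat.{w} R)).map f) := inferInstance
    exact (ModuleCat.epi_iff_surjective _).1 this
  · intro hf
    have : Epi ((forget₂ (FGModuleCat.{w} R) (ModuleCat.{w} R)).map f) :=
      (ModuleCat.epi_iff_surjective _).2 hf
    exact (forget₂ (FGModuleCat.{w} R) (ModuleCat.{w} R)).epi_of_epi_map this

/-- Both objects belong to `U`: the injective satisfies the right-hand Ext condition and the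
projective the left-hand one, for trivial reasons. Degree 1 lies in the range of vanishing because
`2 ≤ d`. -/
theorem IsDClusterTilting.subsingleton_ext_one {C : Type u} [Category.{v} C] [Abelian C]
    [HasExt.{w} C] {d : ℕ} {U : ObjectProperty C} (hU : IsDClusterTilting.{u, v, w} d U)
    (hd : 2 ≤ d) (I P : C) [Injective I] [Projective P] :
    Subsingleton (Abelian.Ext.{w} I P 1) := by
  have hI : U I := by
    rw [hU.eq_rightPerp]
    intro Y _ i hi _
    obtain ⟨n, rfl⟩ := Nat.exists_eq_add_of_le' hi
    exact subsingleton_of_forall_eq 0 Abelian.Ext.eq_zero_of_injective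
  have hP : extLeftPerp.{u, v, w} U d P := by
    intro Y _ i hi _
    obtain ⟨n, rfl⟩ := Nat.exists_eq_add_of_le' hi
    exact subsingleton_of_forall_eq 0 Abelian.Ext.eq_zero_of_projective
  rw [← hU.eq_leftPerp, hU.eq_rightPerp] at hP
  exact hP I hI 1 le_rfl hd

/-- The obstruction to lifting the identity of `S.X₃` along `S.g` is its image under the connecting
map, which lies in the trivial Ext group. -/
theorem CategoryTheory.ShortComplex.ShortExact.exists_section_of_subsingleton_ext {C : Type u}
    [Category.{v} C] [Abelian C] [HasExt.{w} C] {S : ShortComplex C} (hS : S.ShortExact)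
    [Subsingleton (Abelian.Ext.{w} S.X₃ S.X₁ 1)] : ∃ s : S.X₃ ⟶ S.X₂, s ≫ S.g = 𝟙 _ := by
  obtain ⟨x, hx⟩ := Abelian.Ext.covariant_sequence_exact₃ S.X₃ hS
    (Abelian.Ext.mk₀ (𝟙 S.X₃)) (zero_add 1) (Subsingleton.elim _ _)
  obtain ⟨s, rfl⟩ := (Abelian.Ext.mk₀_bijective _ _).2 x
  refine ⟨s, (Abelian.Ext.mk₀_bijective _ _).1 ?_⟩
  rwa [Abelian.Ext.mk₀_comp_mk₀] at hx

variable (R) in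
/-- Extensions of injective by projective objects split in `FGModuleCat R`. -/
def InjProjExtensionsSplit : Prop :=
  ∀ S : ShortComplex (FGModuleCat.{w} R), S.ShortExact → Injective S.X₃ → Projective S.X₁ →
    ∃ s : S.X₃ ⟶ S.X₂, s ≫ S.g = 𝟙 _

theorem InjProjExtensionsSplit.exists_section (h : InjProjExtensionsSplit R)
    {A B E : Type*} [AddCommGroup A] [AddCommGroup B] [AddCommGroup E]
    [Module R A] [Module R B] [Module R E] [Module.Finite R A] [Module.Finite R B]
    [Module.Finite R E] [Module.Projective R A]
    (hB : ∀ (X Y : Type w) [AddCommGroup X] [AddCommGroup Y] [Module R X] [Module R Y]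
      (f : X →ₗ[R] Y) (_ : Function.Injective f) (g : X →ₗ[R] B), ∃ k : Y →ₗ[R] B, k ∘ₗ f = g)
    (f : A →ₗ[R] E) (g : E →ₗ[R] B) (hf : Function.Injective f) (hg : Function.Surjective g)
    (hfg : Function.Exact f g) : ∃ s : B →ₗ[R] E, g ∘ₗ s = LinearMap.id := by
  -- The dual of Λ also involves the universe of `K`, while the category consists of modules in
  -- `Type w`. Finite modules over `R : Type w` are `w`-small, so the sequence is transported to
  -- small copies.
  have := Module.Finite.small.{w} R A
  have := Module.Finite.small.{w} R B
  have := Module.Finite.small.{w} R E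
  let a := Shrink.linearEquiv.{w} R A
  let b := Shrink.linearEquiv.{w} R B
  let e := Shrink.linearEquiv.{w} R E
  let f' : Shrink.{w} A →ₗ[R] Shrink.{w} E := e.symm.toLinearMap ∘ₗ f ∘ₗ a.toLinearMap
  let g' : Shrink.{w} E →ₗ[R] Shrink.{w} B := b.symm.toLinearMap ∘ₗ g ∘ₗ e.toLinearMap
  have hf' : Function.Injective f' := e.symm.injective.comp (hf.comp a.injective)
  have hg' : Function.Surjective g' := b.symm.surjective.comp (hg.comp e.surjective)
  have hfg' : Function.Exact f' g' := by
    intro y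
    constructor
    · intro hy
      have h1 : g (e y) = 0 := b.symm.injective (by simpa [g'] using hy)
      obtain ⟨x, hx⟩ := (hfg _).1 h1
      exact ⟨a.symm x, by simp [f', hx]⟩
    · rintro ⟨x, rfl⟩
      have : g (f (a x)) = 0 := (hfg _).2 ⟨_, rfl⟩
      simp [f', g', this]
  let S : ShortComplex (FGModuleCat.{w} R) := ShortComplex.mk (FGModuleCat.ofHom f')
    (FGModuleCat.ofHom g') (FGModuleCat.hom_ext (LinearMap.ext fun x => (hfg' _).2 ⟨x, rfl⟩))
  have hS : S.ShortExact := by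
    have h1 : Mono S.f := (FGModuleCat.mono_iff_injective _).2 hf'
    have h2 : Epi S.g := (FGModuleCat.epi_iff_surjective _).2 hg'
    refine ⟨?_⟩
    rw [← S.exact_map_iff_of_faithful (forget₂ (FGModuleCat.{w} R) (ModuleCat.{w} R))]
    exact (ShortComplex.ShortExact.moduleCat_exact_iff_function_exact _).2 hfg'
  have hI : Injective S.X₃ := by
    refine ⟨fun {X Y} p i hi => ?_⟩
    obtain ⟨k, hk⟩ := hB X Y i.hom.hom ((FGModuleCat.mono_iff_injective _).1 hi)
      (b.toLinearMap ∘ₗ p.hom.hom)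
    refine ⟨(FGModuleCat.ofHom (b.symm.toLinearMap ∘ₗ k) : FGModuleCat.of R Y ⟶ _), ?_⟩
    refine FGModuleCat.hom_ext (LinearMap.ext fun x => ?_)
    have := LinearMap.congr_fun hk x
    change b.symm (k (i.hom.hom x)) = p.hom.hom x
    rw [LinearEquiv.symm_apply_eq]
    exact this
  have hP : Projective S.X₁ := by
    have : Module.Projective R (Shrink.{w} A) := Module.Projective.of_equiv a.symm
    refine ⟨fun {X Y} p i hi => ?_⟩
    obtain ⟨k, hk⟩ := Module.projective_lifting_property i.hom.hom p.hom.hom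
      ((FGModuleCat.epi_iff_surjective _).1 hi)
    refine ⟨(FGModuleCat.ofHom k : _ ⟶ FGModuleCat.of R X), ?_⟩
    exact FGModuleCat.hom_ext (LinearMap.ext fun x => LinearMap.congr_fun hk x)
  obtain ⟨s, hs⟩ := h S hS hI hP
  let s' : Shrink.{w} B →ₗ[R] Shrink.{w} E := s.hom.hom
  refine ⟨e.toLinearMap ∘ₗ s' ∘ₗ b.symm.toLinearMap, ?_⟩
  ext x
  have h1 : g' (s' (b.symm x)) = b.symm x :=
    LinearMap.congr_fun (congrArg (fun t => t.hom.hom) hs) (b.symm x)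
  exact b.symm.injective h1

end Splitting

theorem HasDClusterTiltingSubcategory.injProjExtensionsSplit {K : Type u} {Λ : Type w} [Field K]
    [Ring Λ] [Algebra K Λ] [Module.Finite K Λ] [IsNoetherianRing Λᵐᵒᵖ] {d : ℕ} (hd : 2 ≤ d)
    (h : HasDClusterTiltingSubcategory K Λ d) : InjProjExtensionsSplit Λᵐᵒᵖ := by
  have : HasExt.{w + 1} (FGModuleCat.{w} Λᵐᵒᵖ) := HasExt.standard _
  obtain ⟨U, hU⟩ := h
  intro S hS hI hP
  have := hU.subsingleton_ext_one hd S.X₃ S.X₁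
  exact hS.exists_section_of_subsingleton_ext

/-! ### Extensions of the dual of Λ by Λ as derivations -/

section Cocycle

variable (K : Type*) (Λ : Type*) [Field K] [Ring Λ] [Algebra K Λ]

/-- The `K`-dual of `Λ`, considered as a right `Λ`-module. -/
def RegularDual := Module.Dual K Λ

namespace RegularDual

instance : AddCommGroup (RegularDual K Λ) := inferInstanceAs (AddCommGroup (Module.Dual K Λ))

instance : Module K (RegularDual K Λ) := inferInstanceAs (Module K (Module.Dual K Λ))

instance [Module.Finite K Λ] : Module.Finite K (RegularDual K Λ) :=
  inferInstanceAs (Module.Finite K (Module.Dual K Λ))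

instance : FunLike (RegularDual K Λ) Λ K := inferInstanceAs (FunLike (Module.Dual K Λ) Λ K)

instance : LinearMapClass (RegularDual K Λ) K Λ K :=
  inferInstanceAs (LinearMapClass (Module.Dual K Λ) K Λ K)

variable {K Λ}

@[ext] theorem ext {f g : RegularDual K Λ} (h : ∀ x, f x = g x) : f = g := DFunLike.ext _ _ h

@[simp] theorem add_apply (f g : RegularDual K Λ) (x : Λ) : (f + g) x = f x + g x := rfl

@[simp] theorem smul_apply (c : K) (f : RegularDual K Λ) (x : Λ) : (c • f) x = c * f x := rfl

instance : Module Λᵐᵒᵖ (RegularDual K Λ) where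
  smul a f := (LinearMap.comp (show Module.Dual K Λ from f) (LinearMap.mulLeft K a.unop) :)
  one_smul f := by ext x; exact congrArg f (one_mul x)
  mul_smul a b f := by ext x; exact congrArg f (mul_assoc b.unop a.unop x)
  smul_zero a := rfl
  smul_add a f g := rfl
  add_smul a b f := by
    ext x
    exact (congrArg f (add_mul a.unop b.unop x)).trans (map_add f _ _)
  zero_smul f := by
    ext x
    exact (congrArg f (zero_mul x)).trans (map_zero f)

@[simp] theorem op_smul_apply (a : Λᵐᵒᵖ) (f : RegularDual K Λ) (x : Λ) :
    (a • f) x = f (a.unop * x) := rfl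

end RegularDual

/-- A cocycle for an extension of right modules of the dual of `Λ` by `Λ`, that is,
a derivation of `Λ` with values in `Hom_K (D Λ, Λ)`. -/
structure DualCocycle where
  toLin : Λ →ₗ[K] RegularDual K Λ →ₗ[K] Λ
  map_mul : ∀ (a b : Λ) (f : RegularDual K Λ),
    toLin (a * b) f = toLin a f * b + toLin b (MulOpposite.op a • f)

namespace DualCocycle

variable {K Λ} (θ : DualCocycle K Λ)

theorem map_one (f : RegularDual K Λ) : θ.toLin 1 f = 0 := by
  have := θ.map_mul 1 1 f
  simpa using this

/-- The middle term of the extension given by a cocycle. -/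
def Extension (_θ : DualCocycle K Λ) := Λ × RegularDual K Λ

instance : AddCommGroup θ.Extension := inferInstanceAs (AddCommGroup (Λ × RegularDual K Λ))

/-- Λ × DΛ carries the action twisted by θ. The Leibniz rule `map_mul` is what makes the action
associative, and `map_one` makes it unital. -/
instance : Module Λᵐᵒᵖ θ.Extension where
  smul a e := (e.1 * a.unop + θ.toLin a.unop e.2, a • e.2)
  one_smul e := by
    refine Prod.ext ?_ (one_smul _ e.2)
    change e.1 * 1 + θ.toLin 1 e.2 = e.1
    rw [map_one, mul_one, add_zero]
  mul_smul a b e := by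
    refine Prod.ext ?_ (mul_smul a b e.2)
    change e.1 * (b.unop * a.unop) + θ.toLin (b.unop * a.unop) e.2 =
      (e.1 * b.unop + θ.toLin b.unop e.2) * a.unop + θ.toLin a.unop (b • e.2)
    rw [θ.map_mul, add_mul, mul_assoc, MulOpposite.op_unop, add_assoc]
  smul_zero a := by
    refine Prod.ext ?_ (smul_zero a)
    change 0 * a.unop + θ.toLin a.unop 0 = 0
    simp
  smul_add a e e' := by
    refine Prod.ext ?_ (smul_add a e.2 e'.2)
    change (e.1 + e'.1) * a.unop + θ.toLin a.unop (e.2 + e'.2) =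
      (e.1 * a.unop + θ.toLin a.unop e.2) + (e'.1 * a.unop + θ.toLin a.unop e'.2)
    rw [map_add, add_mul]; abel
  add_smul a b e := by
    refine Prod.ext ?_ (add_smul a b e.2)
    change e.1 * (a.unop + b.unop) + θ.toLin (a.unop + b.unop) e.2 =
      (e.1 * a.unop + θ.toLin a.unop e.2) + (e.1 * b.unop + θ.toLin b.unop e.2)
    rw [map_add, mul_add, LinearMap.add_apply]; abel
  zero_smul e := by
    refine Prod.ext ?_ (zero_smul _ e.2)
    change e.1 * 0 + θ.toLin 0 e.2 = 0
    simp

/-- The inclusion of `Λ` into the extension given by a cocycle. -/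
def inl : Λ →ₗ[Λᵐᵒᵖ] θ.Extension where
  toFun x := (x, 0)
  map_add' x y := Prod.ext rfl (add_zero 0).symm
  map_smul' a x := by
    refine Prod.ext ?_ (smul_zero a).symm
    change x * a.unop = x * a.unop + θ.toLin a.unop 0
    simp

/-- The projection of the extension given by a cocycle to the dual of `Λ`. -/
def snd : θ.Extension →ₗ[Λᵐᵒᵖ] RegularDual K Λ where
  toFun e := e.2
  map_add' _ _ := rfl
  map_smul' _ _ := rfl

end DualCocycle

end Cocycle

/-- Evaluation at 1 identifies Λ-linear maps into DΛ with `K`-linear forms, so injectivity of DΛ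
reduces to extending a linear form along an injection of vector spaces. -/
theorem RegularDual.exists_extension {K Λ X Y : Type*} [Field K] [Ring Λ] [Algebra K Λ]
    [AddCommGroup X] [AddCommGroup Y] [Module Λᵐᵒᵖ X] [Module Λᵐᵒᵖ Y] (f : X →ₗ[Λᵐᵒᵖ] Y)
    (hf : Function.Injective f) (g : X →ₗ[Λᵐᵒᵖ] RegularDual K Λ) :
    ∃ k : Y →ₗ[Λᵐᵒᵖ] RegularDual K Λ, k ∘ₗ f = g := by
  let _ : Module K X := Module.compHom X (algebraMap K Λᵐᵒᵖ)
  let _ : Module K Y := Module.compHom Y (algebraMap K Λᵐᵒᵖ)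
  have hX (c : K) (x : X) : c • x = algebraMap K Λᵐᵒᵖ c • x := rfl
  have hY (c : K) (x : Y) : c • x = algebraMap K Λᵐᵒᵖ c • x := rfl
  have hop (c : K) : (algebraMap K Λᵐᵒᵖ c).unop = algebraMap K Λ c := rfl
  let fK : X →ₗ[K] Y := { f with map_smul' := fun c x => f.map_smul _ x }
  let gK : X →ₗ[K] K :=
    { toFun := fun x => g x 1
      map_add' := by simp
      map_smul' := fun c x => by
        rw [hX, map_smul, RegularDual.op_smul_apply, hop, mul_one, Algebra.algebraMap_eq_smul_one,
          map_smul]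
        rfl }
  obtain ⟨r, hr⟩ := fK.exists_leftInverse_of_injective (LinearMap.ker_eq_bot.2 hf)
  let l : Y →ₗ[K] K := gK ∘ₗ r
  have hl (x : X) : l (f x) = g x 1 := congrArg gK (LinearMap.congr_fun hr x)
  let k : Y →ₗ[Λᵐᵒᵖ] RegularDual K Λ :=
    { toFun := fun y => (
        { toFun := fun a => l (MulOpposite.op a • y)
          map_add' := fun a b => by rw [MulOpposite.op_add, add_smul, map_add]
          map_smul' := fun c a => by
            rw [RingHom.id_apply, ← l.map_smul, hY, ← mul_smul]
            congr 2
            apply MulOpposite.unop_injective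
            rw [MulOpposite.unop_mul, hop, ← Algebra.commutes, ← Algebra.smul_def]
            rfl } : Module.Dual K Λ)
      map_add' := fun y z => by
        ext a
        exact (congrArg l (smul_add _ y z)).trans (map_add l _ _)
      map_smul' := fun b y => by
        ext a
        exact congrArg l (mul_smul (MulOpposite.op a) b y).symm }
  refine ⟨k, ?_⟩
  ext x a
  change l (MulOpposite.op a • f x) = g x a
  rw [← map_smul, hl, map_smul, RegularDual.op_smul_apply, MulOpposite.unop_op, mul_one]

/-- The first component of a Λ-linear section of the twisted extension serves as `h`; compatibility
with the twisted action is the asserted formula. -/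
theorem DualCocycle.exists_coboundary {K : Type u} {Λ : Type w} [Field K] [Ring Λ] [Algebra K Λ]
    [Module.Finite K Λ] [IsNoetherianRing Λᵐᵒᵖ] (hsplit : InjProjExtensionsSplit Λᵐᵒᵖ)
    (θ : DualCocycle K Λ) : ∃ h : RegularDual K Λ → Λ, ∀ (a : Λ) (f : RegularDual K Λ),
      θ.toLin a f = h (MulOpposite.op a • f) - h f * a := by
  have : Module.Finite Λᵐᵒᵖ (RegularDual K Λ) := by
    have : IsScalarTower K Λᵐᵒᵖ (RegularDual K Λ) := ⟨fun c a f => by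
      ext x
      simp⟩
    exact Module.Finite.of_restrictScalars_finite K _ _
  have hA : Function.Exact θ.inl θ.snd := by
    intro e
    constructor
    · intro he
      exact ⟨e.1, Prod.ext rfl he.symm⟩
    · rintro ⟨x, rfl⟩
      rfl
  have hinj : Function.Injective θ.inl := fun x y h => congrArg Prod.fst h
  have hsurj : Function.Surjective θ.snd := fun f => ⟨((0, f) : Λ × RegularDual K Λ), rfl⟩
  let eL : Λᵐᵒᵖ ≃ₗ[Λᵐᵒᵖ] Λ :=
    { MulOpposite.opAddEquiv.symm with map_smul' := fun a b => rfl }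
  have : Module.Finite Λᵐᵒᵖ Λ := Module.Finite.equiv eL
  have : Module.Projective Λᵐᵒᵖ Λ := Module.Projective.of_equiv eL
  have : Module.Finite Λᵐᵒᵖ θ.Extension := by
    rw [Module.finite_def]
    refine Submodule.fg_of_fg_map_of_fg_inf_ker θ.snd ?_ ?_
    · rw [Submodule.map_top, LinearMap.range_eq_top.2 hsurj]
      exact Module.Finite.fg_top
    · rw [top_inf_eq, LinearMap.exact_iff.1 hA]
      exact Module.Finite.fg_top.map θ.inl |> fun h => by rwa [Submodule.map_top] at h
  obtain ⟨s, hs⟩ := hsplit.exists_section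
    (fun X Y _ _ _ _ f hf g => RegularDual.exists_extension f hf g) θ.inl θ.snd hinj hsurj hA
  have hs2 (f : RegularDual K Λ) : (s f).2 = f := LinearMap.congr_fun hs f
  refine ⟨fun f => (s f).1, fun a f => ?_⟩
  have h : (s (MulOpposite.op a • f)).1 = (s f).1 * a + θ.toLin a (s f).2 :=
    congrArg Prod.fst (s.map_smul (MulOpposite.op a) f)
  rw [hs2] at h
  exact (sub_eq_of_eq_add' h).symm

theorem LinearMap.exists_factor_of_surjective {K V W M : Type*} [Field K] [AddCommGroup V]
    [AddCommGroup W] [AddCommGroup M] [Module K V] [Module K W] [Module K M] (f : V →ₗ[K] W)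
    (hf : Function.Surjective f) (g : V →ₗ[K] M) (h : ∀ x, f x = 0 → g x = 0) :
    ∃ k : W →ₗ[K] M, ∀ x, k (f x) = g x := by
  obtain ⟨s, hs⟩ := f.exists_rightInverse_of_surjective (LinearMap.range_eq_top.2 hf)
  refine ⟨g ∘ₗ s, fun x => ?_⟩
  have h1 : f (s (f x) - x) = 0 := by
    rw [map_sub, sub_eq_zero]
    exact LinearMap.congr_fun hs (f x)
  have h2 := h _ h1
  rwa [map_sub, sub_eq_zero] at h2

/-! ### Coefficient functionals and powers of the arrow ideal -/

namespace PathAlgebra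

variable {K Q : Type*} [Field K] [Quiver Q]

/-- The linear extension of a function on paths. -/
def linLift {M : Type*} [AddCommGroup M] [Module K M] (f : QuiverPath Q → M) :
    PathAlgebra K Q →ₗ[K] M :=
  (Finsupp.linearCombination K f : (QuiverPath Q →₀ K) →ₗ[K] M)

@[simp] theorem linLift_ofPath {M : Type*} [AddCommGroup M] [Module K M] (f : QuiverPath Q → M)
    {x y : Q} (p : Quiver.Path x y) : linLift f (ofPath K p) = f ⟨x, y, p⟩ := by
  unfold linLift ofPath
  erw [Finsupp.linearCombination_single, one_smul]

open Classical in
/-- The coefficient of a path. -/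
def coeff {x y : Q} (p : Quiver.Path x y) : PathAlgebra K Q →ₗ[K] K :=
  linLift fun q => if q = ⟨x, y, p⟩ then 1 else 0

open Classical in
theorem coeff_ofPath {x y z w : Q} (p : Quiver.Path x y) (q : Quiver.Path z w) :
    coeff p (ofPath K q) = if (⟨z, w, q⟩ : QuiverPath Q) = ⟨x, y, p⟩ then 1 else 0 := by
  rw [coeff, linLift_ofPath]

@[simp] theorem coeff_ofPath_self {x y : Q} (p : Quiver.Path x y) :
    coeff p (ofPath K p) = 1 := by
  rw [coeff_ofPath, if_pos rfl]

theorem coeff_ofPath_of_length_ne {x y z w : Q} (p : Quiver.Path x y) (q : Quiver.Path z w)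
    (h : q.length ≠ p.length) : coeff p (ofPath K q) = 0 := by
  rw [coeff_ofPath, if_neg]
  intro e
  exact h (congrArg (fun r : QuiverPath Q => r.2.2.length) e)

/-- This and the next three identities compute how multiplication by an arrow acts on the
coefficients of trivial paths and of the arrow itself. They evaluate the coboundary formula in
`exists_vertex_weight`. -/
theorem coeff_nil_toPath_mul {x y v : Q} (α : x ⟶ y) (a : PathAlgebra K Q) :
    coeff (Quiver.Path.nil : Quiver.Path v v) (ofPath K α.toPath * a) = 0 := by
  induction a using induction with
  | h0 => rw [mul_zero', map_zero]
  | hadd a b ha hb => rw [mul_add', map_add, ha, hb, add_zero]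
  | @hsmul c z w p =>
    rw [mul_smul', map_smul]
    by_cases h : y = z
    · subst h
      rw [ofPath_mul_ofPath, coeff_ofPath_of_length_ne, smul_zero]
      simp
    · rw [ofPath_mul_ofPath_of_ne _ _ h, map_zero, smul_zero]

theorem coeff_nil_mul_toPath {x y v : Q} (α : x ⟶ y) (a : PathAlgebra K Q) :
    coeff (Quiver.Path.nil : Quiver.Path v v) (a * ofPath K α.toPath) = 0 := by
  induction a using induction with
  | h0 => rw [zero_mul', map_zero]
  | hadd a b ha hb => rw [add_mul', map_add, ha, hb, add_zero]
  | @hsmul c z w p =>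
    rw [smul_mul', map_smul]
    by_cases h : w = x
    · subst h
      rw [ofPath_mul_ofPath, coeff_ofPath_of_length_ne, smul_zero]
      simp
    · rw [ofPath_mul_ofPath_of_ne _ _ h, map_zero, smul_zero]

theorem coeff_toPath_mul_toPath {x y : Q} (α : x ⟶ y) (a : PathAlgebra K Q) :
    coeff α.toPath (a * ofPath K α.toPath) = coeff (Quiver.Path.nil : Quiver.Path x x) a := by
  induction a using induction with
  | h0 => rw [zero_mul', map_zero, map_zero]
  | hadd a b ha hb => rw [add_mul', map_add, ha, hb, map_add]
  | @hsmul c z w p =>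
    rw [smul_mul', map_smul, map_smul]
    congr 1
    by_cases h : w = x
    · subst h
      rw [ofPath_mul_ofPath]
      cases p with
      | nil => exact (coeff_ofPath_self α.toPath).trans (coeff_ofPath_self _).symm
      | cons p e => rw [coeff_ofPath_of_length_ne, coeff_ofPath_of_length_ne] <;> simp
    · rw [ofPath_mul_ofPath_of_ne _ _ h, map_zero, coeff_ofPath, if_neg]
      intro e
      exact h (congrArg (fun r : QuiverPath Q => r.2.1) e)

theorem coeff_toPath_toPath_mul {x y : Q} (α : x ⟶ y) (a : PathAlgebra K Q) :
    coeff α.toPath (ofPath K α.toPath * a) = coeff (Quiver.Path.nil : Quiver.Path y y) a := by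
  induction a using induction with
  | h0 => rw [mul_zero', map_zero, map_zero]
  | hadd a b ha hb => rw [mul_add', map_add, ha, hb, map_add]
  | @hsmul c z w p =>
    rw [mul_smul', map_smul, map_smul]
    congr 1
    by_cases h : y = z
    · subst h
      rw [ofPath_mul_ofPath]
      cases p with
      | nil => simp
      | cons p e => rw [coeff_ofPath_of_length_ne, coeff_ofPath_of_length_ne] <;> simp
    · rw [ofPath_mul_ofPath_of_ne _ _ h, map_zero, coeff_ofPath, if_neg]
      intro e
      exact h (congrArg (fun r : QuiverPath Q => r.1) e).symm

variable [Fintype Q]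

/-- The linear span of the paths of length at least `m` is closed under multiplication by paths on
either side, so it is a two-sided ideal containing the generators. -/
theorem mem_span_of_mem_arrowIdealPow {m : ℕ} {a : PathAlgebra K Q}
    (ha : a ∈ arrowIdealPow K Q m) :
    a ∈ Submodule.span K
      {b | ∃ (x y : Q) (p : Quiver.Path x y), m ≤ p.length ∧ b = ofPath K p} := by
  set S := Submodule.span K
    {b : PathAlgebra K Q | ∃ (x y : Q) (p : Quiver.Path x y), m ≤ p.length ∧ b = ofPath K p}
  have hpath {x y : Q} (p : Quiver.Path x y) (hp : m ≤ p.length) : ofPath K p ∈ S :=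
    Submodule.subset_span ⟨x, y, p, hp, rfl⟩
  have hleft (r b : PathAlgebra K Q) (hb : b ∈ S) : r * b ∈ S := by
    induction r using induction with
    | h0 => rw [zero_mul']; exact S.zero_mem
    | hadd r s hr hs => rw [add_mul']; exact S.add_mem hr hs
    | @hsmul c x y q =>
      rw [smul_mul']
      refine S.smul_mem c ?_
      induction hb using Submodule.span_induction with
      | mem b hb =>
        obtain ⟨z, w, p, hp, rfl⟩ := hb
        by_cases h : y = z
        · subst h
          rw [ofPath_mul_ofPath]
          exact hpath _ (by rw [Quiver.Path.length_comp]; omega)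
        · rw [ofPath_mul_ofPath_of_ne _ _ h]; exact S.zero_mem
      | zero => rw [mul_zero']; exact S.zero_mem
      | add b b' _ _ hb hb' => rw [mul_add']; exact S.add_mem hb hb'
      | smul c b _ hb => rw [mul_smul']; exact S.smul_mem c hb
  have hright (r b : PathAlgebra K Q) (hb : b ∈ S) : b * r ∈ S := by
    induction r using induction with
    | h0 => rw [mul_zero']; exact S.zero_mem
    | hadd r s hr hs => rw [mul_add']; exact S.add_mem hr hs
    | @hsmul c x y q =>
      rw [mul_smul']
      refine S.smul_mem c ?_
      induction hb using Submodule.span_induction with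
      | mem b hb =>
        obtain ⟨z, w, p, hp, rfl⟩ := hb
        by_cases h : w = x
        · subst h
          rw [ofPath_mul_ofPath]
          exact hpath _ (by rw [Quiver.Path.length_comp]; omega)
        · rw [ofPath_mul_ofPath_of_ne _ _ h]; exact S.zero_mem
      | zero => rw [zero_mul']; exact S.zero_mem
      | add b b' _ _ hb hb' => rw [add_mul']; exact S.add_mem hb hb'
      | smul c b _ hb => rw [smul_mul']; exact S.smul_mem c hb
  let T : TwoSidedIdeal (PathAlgebra K Q) := TwoSidedIdeal.mk' S S.zero_mem S.add_mem S.neg_mem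
    (fun {x y} h => hleft x y h) (fun {x y} h => hright y x h)
  have hT : arrowIdealPow K Q m ≤ T := by
    refine TwoSidedIdeal.span_le.2 ?_
    rintro _ ⟨x, y, p, hp, rfl⟩
    exact (TwoSidedIdeal.mem_mk' ..).2 (hpath p hp.ge)
  exact (TwoSidedIdeal.mem_mk' ..).1 (hT ha)

theorem coeff_eq_zero_of_mem_arrowIdealPow {m : ℕ} {a : PathAlgebra K Q}
    (ha : a ∈ arrowIdealPow K Q m) {x y : Q} (p : Quiver.Path x y) (hp : p.length < m) :
    coeff p a = 0 := by
  have ha' := mem_span_of_mem_arrowIdealPow ha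
  clear ha
  induction ha' using Submodule.span_induction with
  | mem b hb =>
    obtain ⟨z, w, q, hq, rfl⟩ := hb
    exact coeff_ofPath_of_length_ne _ _ (by omega)
  | zero => exact map_zero _
  | add b b' _ _ hb hb' => rw [map_add, hb, hb', add_zero]
  | smul c b _ hb => rw [map_smul, hb, smul_zero]

end PathAlgebra

/-! ### Derivations of KQ/I from weights on arrows -/

section PathCocycle

open PathAlgebra MulOpposite

variable {K Q Λ : Type*} [Field K] [Quiver Q] [Fintype Q] [Ring Λ] [Algebra K Λ]

/-- The value on an arrow of the derivation `α ↦ G α • (f e * α) - F α • (f α * e')`. -/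
def arrowCocycle (F G : K) (e a e' : Λ) : RegularDual K Λ →ₗ[K] Λ where
  toFun f := (G * f e) • a - (F * f a) • e'
  map_add' f g := by simp only [RegularDual.add_apply, mul_add, add_smul]; abel
  map_smul' c f := by
    simp only [RegularDual.smul_apply, RingHom.id_apply, smul_sub, smul_smul]
    congr 2 <;> ring

/-- The value on `a * b` of a derivation with values `D` on `a` and `D'` on `b`. -/
def leibnizMul (D D' : RegularDual K Λ →ₗ[K] Λ) (a b : Λ) : RegularDual K Λ →ₗ[K] Λ where
  toFun f := D f * b + D' (op a • f)
  map_add' f g := by rw [map_add, smul_add, map_add, add_mul]; abel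
  map_smul' c f := by
    have : op a • c • f = c • op a • f := rfl
    rw [map_smul, this, map_smul, RingHom.id_apply, smul_add, smul_mul_assoc]

variable (φ : PathAlgebra K Q →ₐ[K] Λ) (F G : ∀ x y : Q, (x ⟶ y) → K)

/-- The derivation of the path algebra with prescribed values on arrows, evaluated at a path. -/
def pathCocycle {x : Q} : ∀ {y : Q}, Quiver.Path x y → (RegularDual K Λ →ₗ[K] Λ)
  | _, .nil => 0
  | _, .cons (b := y) (c := z) p α =>
    leibnizMul (pathCocycle p)
      (arrowCocycle (F y z α) (G y z α) (φ (ofPath K (.nil : Quiver.Path y y)))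
        (φ (ofPath K α.toPath)) (φ (ofPath K (.nil : Quiver.Path z z))))
      (φ (ofPath K p)) (φ (ofPath K α.toPath))

theorem pathCocycle_cons {x y z : Q} (p : Quiver.Path x y) (α : y ⟶ z) (f : RegularDual K Λ) :
    pathCocycle φ F G (p.cons α) f = pathCocycle φ F G p f * φ (ofPath K α.toPath) +
      ((G y z α * f (φ (ofPath K p) * φ (ofPath K (.nil : Quiver.Path y y)))) •
        φ (ofPath K α.toPath) - (F y z α * f (φ (ofPath K p) * φ (ofPath K α.toPath))) •
          φ (ofPath K (.nil : Quiver.Path z z))) := rfl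

theorem map_ofPath_mul {x y z : Q} (p : Quiver.Path x y) (q : Quiver.Path y z) :
    φ (ofPath K p) * φ (ofPath K q) = φ (ofPath K (p.comp q)) := by
  rw [← map_mul, ofPath_mul_ofPath]

theorem map_ofPath_mul_of_ne {x y z w : Q} (p : Quiver.Path x y) (q : Quiver.Path z w)
    (h : y ≠ z) : φ (ofPath K p) * φ (ofPath K q) = 0 := by
  rw [← map_mul, ofPath_mul_ofPath_of_ne _ _ h, map_zero]

theorem pathCocycle_mul_nil {x y : Q} (p : Quiver.Path x y) (f : RegularDual K Λ) :
    pathCocycle φ F G p f * φ (ofPath K (.nil : Quiver.Path y y)) = pathCocycle φ F G p f := by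
  cases p with
  | nil => exact zero_mul _
  | cons p α =>
    rw [pathCocycle_cons, add_mul, sub_mul, mul_assoc, smul_mul_assoc, smul_mul_assoc]
    simp only [map_ofPath_mul, Quiver.Path.comp_nil]

theorem pathCocycle_nil_smul {x y : Q} (p : Quiver.Path x y) (f : RegularDual K Λ) :
    pathCocycle φ F G p (op (φ (ofPath K (.nil : Quiver.Path x x))) • f) =
      pathCocycle φ F G p f := by
  induction p with
  | nil => rfl
  | cons p α ih =>
    rw [pathCocycle_cons, pathCocycle_cons, ih]
    simp only [RegularDual.op_smul_apply, unop_op, map_ofPath_mul, Quiver.Path.nil_comp]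

theorem pathCocycle_comp {x y z : Q} (p : Quiver.Path x y) (q : Quiver.Path y z)
    (f : RegularDual K Λ) :
    pathCocycle φ F G (p.comp q) f = pathCocycle φ F G p f * φ (ofPath K q) +
      pathCocycle φ F G q (op (φ (ofPath K p)) • f) := by
  induction q with
  | nil =>
    rw [pathCocycle_mul_nil]
    exact (add_zero _).symm
  | cons q α ih =>
    rw [Quiver.Path.comp_cons, pathCocycle_cons, ih, pathCocycle_cons, add_mul, mul_assoc,
      add_assoc]
    simp only [RegularDual.op_smul_apply, unop_op, map_ofPath_mul]
    simp only [Quiver.Path.comp_nil, Quiver.Path.comp_toPath_eq_cons, Quiver.Path.comp_cons]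

/-- The derivation of the path algebra with prescribed values on arrows. -/
def pathAlgebraCocycle : PathAlgebra K Q →ₗ[K] RegularDual K Λ →ₗ[K] Λ :=
  linLift fun p => pathCocycle φ F G p.2.2

theorem pathAlgebraCocycle_ofPath {x y : Q} (p : Quiver.Path x y) :
    pathAlgebraCocycle φ F G (ofPath K p) = pathCocycle φ F G p :=
  linLift_ofPath _ _

theorem pathAlgebraCocycle_mul (a b : PathAlgebra K Q) (f : RegularDual K Λ) :
    pathAlgebraCocycle φ F G (a * b) f =
      pathAlgebraCocycle φ F G a f * φ b + pathAlgebraCocycle φ F G b (op (φ a) • f) := by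
  induction a using induction with
  | h0 => simp
  | hadd a a' h h' =>
    rw [add_mul, map_add, map_add, LinearMap.add_apply, LinearMap.add_apply, h, h', map_add,
      MulOpposite.op_add, add_smul, map_add, add_mul]
    abel
  | @hsmul c x y p =>
    have hs (r : Λ) : op (c • r) • f = c • op r • f := by
      ext z
      simp
    rw [PathAlgebra.smul_mul', map_smul, map_smul, LinearMap.smul_apply, LinearMap.smul_apply,
      map_smul φ, hs,
      map_smul, smul_mul_assoc, ← smul_add]
    congr 1
    induction b using induction with
    | h0 => simp
    | hadd b b' h h' =>
      rw [mul_add, map_add, map_add, map_add, LinearMap.add_apply, LinearMap.add_apply, h, h',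
        mul_add]
      abel
    | @hsmul d z w q =>
      rw [mul_smul', map_smul, map_smul φ, map_smul (pathAlgebraCocycle φ F G) d (ofPath K q),
        LinearMap.smul_apply, LinearMap.smul_apply,
        mul_smul_comm, ← smul_add]
      congr 1
      by_cases h : y = z
      · subst h
        rw [ofPath_mul_ofPath]
        simp only [pathAlgebraCocycle_ofPath, pathCocycle_comp]
      · rw [ofPath_mul_ofPath_of_ne _ _ h]
        simp only [pathAlgebraCocycle_ofPath]
        -- Both Leibniz terms vanish for non-composable paths: inserting the idempotent at the end
        -- of `p`, respectively at the start of `q`, produces a product of non-composable paths.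
        rw [← pathCocycle_mul_nil, mul_assoc, map_ofPath_mul_of_ne _ _ _ h,
          ← pathCocycle_nil_smul φ F G q, ← mul_smul, ← op_mul, map_ofPath_mul_of_ne _ _ _ h]
        simp

theorem pathAlgebraCocycle_toPath {x y : Q} (α : x ⟶ y) (f : RegularDual K Λ) :
    pathAlgebraCocycle φ F G (ofPath K α.toPath) f =
      (G x y α * f (φ (ofPath K (.nil : Quiver.Path x x)))) • φ (ofPath K α.toPath) -
        (F x y α * f (φ (ofPath K α.toPath))) • φ (ofPath K (.nil : Quiver.Path y y)) := by
  rw [pathAlgebraCocycle_ofPath]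
  refine (pathCocycle_cons φ F G Quiver.Path.nil α f).trans ?_
  simp only [map_ofPath_mul, Quiver.Path.nil_comp]
  rw [show pathCocycle φ F G (Quiver.Path.nil : Quiver.Path x x) f = 0 from rfl, zero_mul,
    zero_add]

/-- Once the terms containing αβ are dropped, what remains is (G(β) - F(α)) f(α) β. -/
theorem pathAlgebraCocycle_arrowMul {x y z : Q} (α : x ⟶ y) (β : y ⟶ z)
    (h : φ (arrowMul K α β) = 0) (hFG : G y z β = F x y α) :
    pathAlgebraCocycle φ F G (arrowMul K α β) = 0 := by
  ext f
  rw [arrowMul, ← map_ofPath_mul] at h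
  rw [arrowMul, ← ofPath_mul_ofPath, pathAlgebraCocycle_mul, pathAlgebraCocycle_toPath,
    pathAlgebraCocycle_toPath, sub_mul, smul_mul_assoc, smul_mul_assoc, h, hFG]
  simp only [RegularDual.op_smul_apply, unop_op, h, map_ofPath_mul, Quiver.Path.comp_nil,
    Quiver.Path.nil_comp]
  simp

/-- By the Leibniz rule, the common kernel of `φ` and the derivation is a two-sided ideal. It
contains the quadratic generators of `I`, so the derivation descends to Λ. -/
theorem exists_dualCocycle {I : TwoSidedIdeal (PathAlgebra K Q)}
    (hφ : Function.Surjective φ) (hker : ∀ a, φ a = 0 ↔ a ∈ I)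
    (hI : I = TwoSidedIdeal.span
      {a | a ∈ I ∧ ∃ (x y z : Q) (α : x ⟶ y) (β : y ⟶ z), a = arrowMul K α β})
    (hFG : ∀ (x y z : Q) (α : x ⟶ y) (β : y ⟶ z), arrowMul K α β ∈ I → G y z β = F x y α) :
    ∃ θ : DualCocycle K Λ, ∀ a, θ.toLin (φ a) = pathAlgebraCocycle φ F G a := by
  let T : TwoSidedIdeal (PathAlgebra K Q) := TwoSidedIdeal.mk'
    {a | φ a = 0 ∧ pathAlgebraCocycle φ F G a = 0} (by simp)
    (fun {x y} hx hy => by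
      refine ⟨?_, ?_⟩
      · rw [map_add, hx.1, hy.1, add_zero]
      · rw [map_add, hx.2, hy.2, add_zero])
    (fun {x} hx => by
      refine ⟨?_, ?_⟩
      · rw [map_neg, hx.1, neg_zero]
      · rw [map_neg, hx.2, neg_zero])
    (fun {x y} hy => by
      refine ⟨by rw [map_mul, hy.1, mul_zero], ?_⟩
      ext f
      rw [pathAlgebraCocycle_mul, hy.1, hy.2]
      simp)
    (fun {x y} hx => by
      refine ⟨by rw [map_mul, hx.1, zero_mul], ?_⟩
      ext f
      rw [pathAlgebraCocycle_mul, hx.1, hx.2]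
      simp)
  have hT : I ≤ T := by
    rw [hI]
    refine TwoSidedIdeal.span_le.2 ?_
    rintro _ ⟨ha, x, y, z, α, β, rfl⟩
    refine (TwoSidedIdeal.mem_mk' ..).2 ⟨(hker _).2 ha, ?_⟩
    exact pathAlgebraCocycle_arrowMul φ F G α β ((hker _).2 ha) (hFG _ _ _ α β ha)
  obtain ⟨t, ht⟩ := LinearMap.exists_factor_of_surjective φ.toLinearMap hφ
    (pathAlgebraCocycle φ F G) fun a ha =>
      ((TwoSidedIdeal.mem_mk' ..).1 (hT ((hker a).1 ha))).2
  refine ⟨⟨t, fun a b f => ?_⟩, ht⟩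
  obtain ⟨a, rfl⟩ := hφ a
  obtain ⟨b, rfl⟩ := hφ b
  have ht' (a : PathAlgebra K Q) : t (φ a) = pathAlgebraCocycle φ F G a := ht a
  rw [← map_mul, ht', ht', ht', pathAlgebraCocycle_mul]

end PathCocycle

-- The derivation built from `F` and `G` is inner, θ(a)(f) = h(fa) - h(f)a. Since `I ⊆ J²`, the
-- coefficients χ_v of e_v and k of α descend to Λ. For α : x ⟶ y one has χ_x α = 0 and kα = χ_y.
-- Thus G(α) α = -h(χ_x) α, and the coefficient of α gives G(α) = -χ_x(h(χ_x)); likewise -F(α) e_y =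
-- h(χ_y) - h(k) α, and the coefficient of e_y gives F(α) = -χ_y(h(χ_y)).
open PathAlgebra MulOpposite in
theorem exists_vertex_weight {K : Type u} {Λ : Type w} {Q : Type*} [Field K] [Ring Λ]
    [Algebra K Λ] [Module.Finite K Λ] [IsNoetherianRing Λᵐᵒᵖ] [Quiver Q] [Fintype Q]
    (hsplit : InjProjExtensionsSplit Λᵐᵒᵖ)
    (φ : PathAlgebra K Q →ₐ[K] Λ) {I : TwoSidedIdeal (PathAlgebra K Q)}
    (hφ : Function.Surjective φ) (hker : ∀ a, φ a = 0 ↔ a ∈ I)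
    (hI2 : I ≤ arrowIdealPow K Q 2) (hI : I = TwoSidedIdeal.span
      {a | a ∈ I ∧ ∃ (x y z : Q) (α : x ⟶ y) (β : y ⟶ z), a = arrowMul K α β})
    (F G : ∀ x y : Q, (x ⟶ y) → K)
    (hFG : ∀ (x y z : Q) (α : x ⟶ y) (β : y ⟶ z), arrowMul K α β ∈ I → G y z β = F x y α) :
    ∃ c : Q → K, ∀ (x y : Q) (α : x ⟶ y), G x y α = c x ∧ F x y α = c y := by
  obtain ⟨θ, hθ⟩ := exists_dualCocycle φ F G hφ hker hI hFG
  obtain ⟨h, hh⟩ := θ.exists_coboundary hsplit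
  have h0 : h 0 = 0 := by simpa using (hh 0 0).symm
  have hcoeff {x y : Q} (p : Quiver.Path x y) (hp : p.length < 2) :
      ∃ k : RegularDual K Λ, ∀ a, k (φ a) = coeff p a :=
    LinearMap.exists_factor_of_surjective φ.toLinearMap hφ (coeff p) fun a ha =>
      coeff_eq_zero_of_mem_arrowIdealPow (hI2 ((hker a).1 ha)) p hp
  choose χ hχ using fun x : Q => hcoeff (Quiver.Path.nil : Quiver.Path x x) (by simp)
  refine ⟨fun v => -χ v (h (χ v)), fun x y α => ?_⟩
  obtain ⟨k, hk⟩ := hcoeff α.toPath (by simp)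
  have ha := hθ (ofPath K α.toPath)
  have h1 := hh (φ (ofPath K α.toPath)) (χ x)
  have h2 := hh (φ (ofPath K α.toPath)) k
  have e1 : op (φ (ofPath K α.toPath)) • χ x = 0 := by
    ext b
    obtain ⟨b, rfl⟩ := hφ b
    rw [RegularDual.op_smul_apply, unop_op, ← map_mul, hχ, coeff_nil_toPath_mul]
    rfl
  have e2 : op (φ (ofPath K α.toPath)) • k = χ y := by
    ext b
    obtain ⟨b, rfl⟩ := hφ b
    rw [RegularDual.op_smul_apply, unop_op, ← map_mul, hk, hχ, coeff_toPath_toPath_mul]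
  have e3 (b : Λ) : k (b * φ (ofPath K α.toPath)) = χ x b := by
    obtain ⟨b, rfl⟩ := hφ b
    rw [← map_mul, hk, hχ, coeff_toPath_mul_toPath]
  have e4 (b : Λ) : χ y (b * φ (ofPath K α.toPath)) = 0 := by
    obtain ⟨b, rfl⟩ := hφ b
    rw [← map_mul, hχ, coeff_nil_mul_toPath]
  have e5 : χ x (φ (ofPath K α.toPath)) = 0 := by
    rw [hχ, coeff_ofPath_of_length_ne _ _ (by simp)]
  have e6 : k (φ (ofPath K (Quiver.Path.nil : Quiver.Path x x))) = 0 := by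
    rw [hk, coeff_ofPath_of_length_ne _ _ (by simp)]
  have e7 (v : Q) : χ v (φ (ofPath K (Quiver.Path.nil : Quiver.Path v v))) = 1 := by
    rw [hχ, coeff_ofPath_self]
  have e8 : k (φ (ofPath K α.toPath)) = 1 := by rw [hk, coeff_ofPath_self]
  rw [ha, pathAlgebraCocycle_toPath, e1, h0, e5, e7] at h1
  rw [ha, pathAlgebraCocycle_toPath, e2, e6, e8] at h2
  constructor
  · have := congrArg k h1
    simpa [e3, e8] using this
  · have := congrArg (χ y) h2
    simp only [mul_zero, zero_smul, zero_sub, mul_one, map_neg, map_sub, map_smul, e7, e4,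
      sub_zero, smul_eq_mul] at this
    simp only [← this, neg_neg]

/-! ### Connected finite quivers with at most one arrow into and out of each vertex -/

theorem exists_perm_extending {Q : Type*} [Finite Q] (R : Q → Q → Prop)
    (hf : ∀ x y y', R x y → R x y' → y = y') (hi : ∀ x x' y, R x y → R x' y → x = x') :
    ∃ π : Equiv.Perm Q, ∀ x y, R x y → π x = y := by
  classical
  choose s hs using fun x : {x // ∃ y, R x y} => x.2
  let e : {x // ∃ y, R x y} ≃ {y // ∃ x, R x y} :=
    Equiv.ofBijective (fun x => ⟨s x, x, hs x⟩) <| by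
      constructor
      · intro x x' h
        have h' : s x = s x' := congrArg Subtype.val h
        exact Subtype.ext (hi _ _ _ (hs x) (h' ▸ hs x'))
      · rintro ⟨y, x, h⟩
        exact ⟨⟨x, y, h⟩, Subtype.ext (hf _ _ _ (hs _) h)⟩
  refine ⟨e.extendSubtype, fun x y h => ?_⟩
  rw [e.extendSubtype_apply_of_mem x ⟨y, h⟩]
  exact hf _ _ _ (hs _) h

/-- The partial injection `R` extends to a permutation π, and connectedness makes π a single cycle.
Either every step of π comes from `R`, giving a cycle, or `R` has a sink; cutting π after the sink
gives a line. -/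
theorem exists_enumeration {Q : Type*} [Fintype Q] [Nonempty Q] (R : Q → Q → Prop)
    (hf : ∀ x y y', R x y → R x y' → y = y') (hi : ∀ x x' y, R x y → R x' y → x = x')
    (hconn : ∀ S : Set Q, (∀ x y, R x y → (x ∈ S ↔ y ∈ S)) → S = ∅ ∨ S = Set.univ) :
    ∃ (n : ℕ) (σ : Fin (n + 1) ≃ Q), (∀ i j, R (σ i) (σ j) ↔ i.val + 1 = j.val) ∨
      ∀ i j, R (σ i) (σ j) ↔ (i.val + 1) % (n + 1) = j.val := by
  obtain ⟨π, hπ⟩ := exists_perm_extending R hf hi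
  have hcycle : π.IsCycleOn (Finset.univ : Finset Q) := by
    refine ⟨by simp [Set.bijOn_univ], fun x _ y _ => ?_⟩
    have h : {y | π.SameCycle x y} = Set.univ := by
      refine (hconn {y | π.SameCycle x y} fun a b hab => ?_).resolve_left fun h => ?_
      · rw [← hπ a b hab]
        exact Equiv.Perm.sameCycle_apply_right.symm
      · exact h.subset (Equiv.Perm.SameCycle.refl π x)
    exact h.superset (Set.mem_univ y)
  obtain ⟨n, hn⟩ : ∃ n, Fintype.card Q = n + 1 :=
    Nat.exists_eq_add_of_le' Fintype.card_pos
  have hpow (x : Q) (i j : ℕ) : (π ^ i) x = (π ^ j) x ↔ i ≡ j [MOD n + 1] := by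
    rw [hcycle.pow_apply_eq_pow_apply (Finset.mem_univ x), Finset.card_univ, hn]
  have hbij (x : Q) : Function.Bijective fun i : Fin (n + 1) => (π ^ i.val) x := by
    rw [Fintype.bijective_iff_injective_and_card, hn, Fintype.card_fin]
    refine ⟨fun i j h => ?_, rfl⟩
    have := (hpow x i j).1 h
    rw [Nat.ModEq, Nat.mod_eq_of_lt i.2, Nat.mod_eq_of_lt j.2] at this
    exact Fin.ext this
  have hsucc (x : Q) (i j : Fin (n + 1)) :
      π ((π ^ i.val) x) = (π ^ j.val) x ↔ (i.val + 1) % (n + 1) = j.val := by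
    rw [← Equiv.Perm.mul_apply, ← pow_succ', hpow, Nat.ModEq, Nat.mod_eq_of_lt j.2]
  by_cases hsink : ∃ s, ∀ y, ¬ R s y
  · obtain ⟨s, hs⟩ := hsink
    -- Starting just after the sink places `s` in the last position.
    let σ := Equiv.ofBijective _ (hbij (π s))
    have hσ (i j) : π (σ i) = σ j ↔ (i.val + 1) % (n + 1) = j.val := hsucc _ i j
    have hlast (j) : ¬ R (σ (Fin.last n)) j := by
      have h1 : π (σ (Fin.last n)) = σ 0 := (hσ _ _).2 (by simp)
      have h2 : σ 0 = π s := rfl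
      rw [π.injective (h1.trans h2)]
      exact hs j
    have hout (i : Fin (n + 1)) (hin : i.val < n) : ∃ y, R (σ i) y := by
      -- If the `i`-th vertex had no successor, the initial segment up to `i` would be closed under
      -- `R` in both directions, yet it is nonempty and misses the last vertex.
      by_contra hno
      have hS : ∀ x y, R x y → (x ∈ {y | (σ.symm y).val ≤ i.val} ↔
          y ∈ {y | (σ.symm y).val ≤ i.val}) := by
        intro x y hxy
        obtain ⟨a, rfl⟩ := σ.surjective x
        obtain ⟨b, rfl⟩ := σ.surjective y
        have hab := (hσ a b).1 (hπ _ _ hxy)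
        have ha : a.val ≠ n := by
          intro h
          rw [show a = Fin.last n from Fin.ext h] at hxy
          exact hlast _ hxy
        have hai : a.val ≠ i.val := by
          intro h
          rw [Fin.ext h] at hxy
          exact hno ⟨_, hxy⟩
        have := a.2
        rw [Nat.mod_eq_of_lt (by omega)] at hab
        simp only [Set.mem_ofPred_eq, Equiv.symm_apply_apply]
        omega
      rcases hconn _ hS with h | h
      · exact h.subset (show σ i ∈ {y | (σ.symm y).val ≤ i.val} by simp)
      · have : σ (Fin.last n) ∈ {y | (σ.symm y).val ≤ i.val} := h.superset (Set.mem_univ _)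
        simp only [Set.mem_ofPred_eq, Equiv.symm_apply_apply, Fin.val_last] at this
        omega
    refine ⟨n, σ, Or.inl fun i j => ⟨fun h => ?_, fun h => ?_⟩⟩
    · have hab := (hσ i j).1 (hπ _ _ h)
      have ha : i.val ≠ n := by
        intro hi
        rw [show i = Fin.last n from Fin.ext hi] at h
        exact hlast _ h
      have := i.2
      rwa [Nat.mod_eq_of_lt (by omega)] at hab
    · have := j.2
      obtain ⟨y, hy⟩ := hout i (by omega)
      rwa [← (hσ i j).2 (by rw [Nat.mod_eq_of_lt (by omega), h]), hπ _ _ hy]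
  · push Not at hsink
    obtain ⟨x⟩ := ‹Nonempty Q›
    let σ := Equiv.ofBijective _ (hbij x)
    refine ⟨n, σ, Or.inr fun i j => ?_⟩
    rw [← show π (σ i) = σ j ↔ _ from hsucc x i j]
    refine ⟨hπ _ _, fun h => ?_⟩
    obtain ⟨y, hy⟩ := hsink (σ i)
    rwa [← h, hπ _ _ hy]

/-! ### Radical square zero path algebras of isomorphic quivers -/

namespace PathAlgebra

theorem ofPath_nil_congr {K Q : Type*} [Field K] [Quiver Q] {x x' : Q} (h : x = x') :
    ofPath K (.nil : Quiver.Path x x) = ofPath K (.nil : Quiver.Path x' x') := by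
  subst h; rfl

theorem ofPath_toPath_congr {K Q : Type*} [Field K] [Quiver Q] [∀ x y : Q, Subsingleton (x ⟶ y)]
    {x x' y y' : Q} (hx : x = x') (hy : y = y') (α : x ⟶ y) (α' : x' ⟶ y') :
    ofPath K α.toPath = ofPath K α'.toPath := by
  subst hx hy
  rw [Subsingleton.elim α α']

variable {K Q Q' : Type*} [Field K] [Quiver Q] [Quiver Q'] [Fintype Q] [Fintype Q']

theorem algHom_ext {A : Type*} [Ring A] [Algebra K A] {f g : PathAlgebra K Q →ₐ[K] A}
    (hnil : ∀ x : Q, f (ofPath K (.nil : Quiver.Path x x)) = g (ofPath K (.nil : Quiver.Path x x)))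
    (harrow : ∀ (x y : Q) (α : x ⟶ y), f (ofPath K α.toPath) = g (ofPath K α.toPath)) :
    f = g := by
  have hpath {x y : Q} (p : Quiver.Path x y) : f (ofPath K p) = g (ofPath K p) := by
    induction p with
    | nil => exact hnil x
    | cons p α ih =>
      have : ofPath K (p.cons α) = ofPath K p * ofPath K α.toPath := by
        rw [ofPath_mul_ofPath, Quiver.Path.comp_toPath_eq_cons]
      rw [this, map_mul, map_mul, ih, harrow]
  ext a
  induction a using induction with
  | h0 => rw [map_zero, map_zero]
  | hadd a b ha hb => rw [map_add, map_add, ha, hb]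
  | hsmul c p => rw [map_smul, map_smul, hpath]

/-- The algebra homomorphism induced by a prefunctor that is bijective on vertices. -/
def mapAlgHom (F : Q ⥤q Q') (hF : Function.Bijective F.obj) :
    PathAlgebra K Q →ₐ[K] PathAlgebra K Q' :=
  let L : PathAlgebra K Q →ₗ[K] PathAlgebra K Q' :=
    (Finsupp.linearCombination K fun p : QuiverPath Q => ofPath K (F.mapPath p.2.2) :
      (QuiverPath Q →₀ K) →ₗ[K] PathAlgebra K Q')
  have hL {x y : Q} (p : Quiver.Path x y) : L (ofPath K p) = ofPath K (F.mapPath p) := by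
    change Finsupp.linearCombination K _ (Finsupp.single _ _) = _
    erw [Finsupp.linearCombination_single, one_smul]
  AlgHom.ofLinearMap L
    (by
      rw [one_def, one_def, map_sum]
      simp only [hL, Prefunctor.mapPath_nil]
      exact hF.sum_comp fun y : Q' => ofPath K (Quiver.Path.nil : Quiver.Path y y))
    (fun a b => by
      induction a using induction with
      | h0 => simp
      | hadd a a' h h' => rw [add_mul, map_add, map_add, h, h', add_mul]
      | @hsmul c x y p =>
        rw [PathAlgebra.smul_mul', map_smul, map_smul, PathAlgebra.smul_mul']
        congr 1
        induction b using induction with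
        | h0 => simp
        | hadd b b' h h' => rw [mul_add, map_add, map_add, h, h', mul_add]
        | @hsmul d z w q =>
          rw [mul_smul', map_smul, map_smul, mul_smul', hL, hL]
          congr 1
          by_cases h : y = z
          · subst h
            rw [ofPath_mul_ofPath, ofPath_mul_ofPath, hL, Prefunctor.mapPath_comp]
          · rw [ofPath_mul_ofPath_of_ne _ _ h, ofPath_mul_ofPath_of_ne _ _ (hF.1.ne h), map_zero])

theorem mapAlgHom_ofPath (F : Q ⥤q Q') (hF : Function.Bijective F.obj) {x y : Q}
    (p : Quiver.Path x y) : mapAlgHom F hF (ofPath K p) = ofPath K (F.mapPath p) := by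
  change Finsupp.linearCombination K _ (Finsupp.single _ _) = _
  erw [Finsupp.linearCombination_single, one_smul]

theorem mapAlgHom_mem_arrowIdealPow (F : Q ⥤q Q') (hF : Function.Bijective F.obj) {m : ℕ}
    {a : PathAlgebra K Q} (ha : a ∈ arrowIdealPow K Q m) :
    mapAlgHom F hF a ∈ arrowIdealPow K Q' m := by
  have h : arrowIdealPow K Q m ≤ (arrowIdealPow K Q' m).comap (mapAlgHom (K := K) F hF) := by
    refine TwoSidedIdeal.span_le.2 ?_
    rintro _ ⟨x, y, p, hp, rfl⟩
    refine (TwoSidedIdeal.mem_comap _).2 ?_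
    rw [mapAlgHom_ofPath]
    refine TwoSidedIdeal.subset_span ⟨_, _, F.mapPath p, ?_, rfl⟩
    rw [← hp]
    clear hp
    induction p with
    | nil => rfl
    | cons p α ih => rw [Prefunctor.mapPath_cons, Quiver.Path.length_cons, ih,
        Quiver.Path.length_cons]
  exact (TwoSidedIdeal.mem_comap _).1 (h ha)

/-- Hom-sets have at most one element, so arrows chosen arbitrarily over `σ` and its inverse already
give mutually inverse algebra maps, which preserve path length and hence J². -/
theorem nonempty_radSqZeroPathAlgebra_algEquiv (σ : Q ≃ Q') (hQ : ∀ x y : Q, Subsingleton (x ⟶ y))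
    (hQ' : ∀ x y : Q', Subsingleton (x ⟶ y))
    (hσ : ∀ x y, Nonempty (x ⟶ y) ↔ Nonempty (σ x ⟶ σ y)) :
    Nonempty (RadSqZeroPathAlgebra K Q ≃ₐ[K] RadSqZeroPathAlgebra K Q') := by
  let F : Q ⥤q Q' := ⟨σ, fun {x y} α => ((hσ x y).1 ⟨α⟩).some⟩
  let G : Q' ⥤q Q := ⟨σ.symm, fun {x y} α =>
    ((hσ _ _).2 (by rw [σ.apply_symm_apply, σ.apply_symm_apply]; exact ⟨α⟩)).some⟩
  let f := mapAlgHom (K := K) F σ.bijective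
  let g := mapAlgHom (K := K) G σ.symm.bijective
  have hfg : f.comp g = AlgHom.id K _ := by
    refine algHom_ext (fun x => ?_) fun x y α => ?_
    · rw [AlgHom.comp_apply, mapAlgHom_ofPath, Prefunctor.mapPath_nil, mapAlgHom_ofPath,
        Prefunctor.mapPath_nil]
      exact ofPath_nil_congr (σ.apply_symm_apply x)
    · rw [AlgHom.comp_apply, mapAlgHom_ofPath, Prefunctor.mapPath_toPath, mapAlgHom_ofPath,
        Prefunctor.mapPath_toPath]
      exact ofPath_toPath_congr (σ.apply_symm_apply x) (σ.apply_symm_apply y) _ _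
  have hgf : g.comp f = AlgHom.id K _ := by
    refine algHom_ext (fun x => ?_) fun x y α => ?_
    · rw [AlgHom.comp_apply, mapAlgHom_ofPath, Prefunctor.mapPath_nil, mapAlgHom_ofPath,
        Prefunctor.mapPath_nil]
      exact ofPath_nil_congr (σ.symm_apply_apply x)
    · rw [AlgHom.comp_apply, mapAlgHom_ofPath, Prefunctor.mapPath_toPath, mapAlgHom_ofPath,
        Prefunctor.mapPath_toPath]
      exact ofPath_toPath_congr (σ.symm_apply_apply x) (σ.symm_apply_apply y) _ _
  let e : PathAlgebra K Q ≃ₐ[K] PathAlgebra K Q' := AlgEquiv.ofAlgHom f g hfg hgf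
  refine ⟨RingCon.congrₐ K e ?_⟩
  ext a b
  rw [RingCon.comap_rel, TwoSidedIdeal.rel_iff, TwoSidedIdeal.rel_iff, ← map_sub]
  refine ⟨mapAlgHom_mem_arrowIdealPow F σ.bijective, fun h => ?_⟩
  have := mapAlgHom_mem_arrowIdealPow G σ.symm.bijective h
  rwa [show mapAlgHom G σ.symm.bijective (e (a - b)) = a - b from
    AlgHom.congr_fun hgf (a - b)] at this

end PathAlgebra

/-! ### From a connected algebra to a line or a cycle -/

namespace PathAlgebra

variable {K Q : Type*} [Field K] [Quiver Q] [Fintype Q]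

-- The sum of the trivial paths at the vertices of `S` is a central idempotent, because no arrow
-- crosses the boundary of `S`. Its image in Λ is 0 or 1, and coefficients of trivial paths are
-- still visible modulo J².
open Classical in
theorem eq_empty_or_univ_of_isConnectedRing {Λ : Type*} [Ring Λ] [Algebra K Λ]
    (hΛ : IsConnectedRing Λ) (φ : PathAlgebra K Q →ₐ[K] Λ) (hφ : Function.Surjective φ)
    (hker : ∀ a, φ a = 0 → a ∈ arrowIdealPow K Q 2) (S : Set Q)
    (hS : ∀ x y : Q, Nonempty (x ⟶ y) → (x ∈ S ↔ y ∈ S)) : S = ∅ ∨ S = Set.univ := by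
  let e : PathAlgebra K Q := ∑ x : Q, if x ∈ S then ofPath K (.nil : Quiver.Path x x) else 0
  have hpath {x y : Q} (p : Quiver.Path x y) : x ∈ S ↔ y ∈ S := by
    induction p with
    | nil => rfl
    | cons p α ih => exact ih.trans (hS _ _ ⟨α⟩)
  have hleft {x y : Q} (p : Quiver.Path x y) :
      e * ofPath K p = if x ∈ S then ofPath K p else 0 := by
    rw [Finset.sum_mul, Finset.sum_eq_single x]
    · split_ifs
      · rw [ofPath_mul_ofPath, Quiver.Path.nil_comp]
      · rw [zero_mul]
    · intro z _ hz
      split_ifs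
      · rw [ofPath_mul_ofPath_of_ne _ _ hz]
      · rw [zero_mul]
    · simp
  have hright {x y : Q} (p : Quiver.Path x y) :
      ofPath K p * e = if y ∈ S then ofPath K p else 0 := by
    rw [Finset.mul_sum, Finset.sum_eq_single y]
    · split_ifs
      · rw [ofPath_mul_ofPath, Quiver.Path.comp_nil]
      · rw [mul_zero]
    · intro z _ hz
      split_ifs
      · rw [ofPath_mul_ofPath_of_ne _ _ hz.symm]
      · rw [mul_zero]
    · simp
  have hcomm (a : PathAlgebra K Q) : a * e = e * a := by
    induction a using induction with
    | h0 => rw [zero_mul, mul_zero]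
    | hadd a b ha hb => rw [add_mul, mul_add, ha, hb]
    | hsmul c p => rw [PathAlgebra.smul_mul', mul_smul', hleft, hright, if_congr (hpath p) rfl rfl]
  have hidem : e * e = e := by
    conv_lhs => enter [2]; unfold e
    rw [Finset.mul_sum]
    refine Finset.sum_congr rfl fun x _ => ?_
    split_ifs with h
    · rw [hleft, if_pos h]
    · rw [mul_zero]
  have hcoeff (x : Q) : coeff (Quiver.Path.nil : Quiver.Path x x) e = if x ∈ S then 1 else 0 := by
    rw [map_sum, Finset.sum_eq_single x]
    · split_ifs
      · rw [coeff_ofPath_self]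
      · rw [map_zero]
    · intro z _ hz
      split_ifs
      · rw [coeff_ofPath, if_neg]
        intro h
        exact hz (congrArg (fun r : QuiverPath Q => r.1) h)
      · rw [map_zero]
    · simp
  have hone (x : Q) : coeff (Quiver.Path.nil : Quiver.Path x x) (1 : PathAlgebra K Q) = 1 := by
    rw [one_def, map_sum, Finset.sum_eq_single x]
    · rw [coeff_ofPath_self]
    · intro z _ hz
      rw [coeff_ofPath, if_neg]
      intro h
      exact hz (congrArg (fun r : QuiverPath Q => r.1) h)
    · simp
  have hcenter : φ e ∈ Subring.center Λ := by
    rw [Subring.mem_center_iff]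
    intro b
    obtain ⟨a, rfl⟩ := hφ b
    rw [← map_mul, ← map_mul, hcomm]
  rcases hΛ.2 (φ e) hcenter (by rw [← map_mul, hidem]) with h | h
  · left
    refine Set.eq_empty_iff_forall_notMem.2 fun x hx => ?_
    have := coeff_eq_zero_of_mem_arrowIdealPow (hker e h) (.nil : Quiver.Path x x) (by simp)
    rw [hcoeff, if_pos hx] at this
    exact one_ne_zero this
  · right
    refine Set.eq_univ_of_forall fun x => ?_
    by_contra hx
    have h' : φ (e - 1) = 0 := by rw [map_sub, h, map_one, sub_self]
    have := coeff_eq_zero_of_mem_arrowIdealPow (hker _ h') (.nil : Quiver.Path x x) (by simp)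
    rw [map_sub, hcoeff, if_neg hx, hone, zero_sub, neg_eq_zero] at this
    exact one_ne_zero this

theorem isRadSqZeroNakayama_of_subsingleton_star {Λ : Type*} [Ring Λ] [Algebra K Λ]
    (hΛ : IsConnectedRing Λ) (e : Λ ≃ₐ[K] RadSqZeroPathAlgebra K Q)
    (hstar : ∀ x : Q, Subsingleton (Quiver.Star x))
    (hcostar : ∀ x : Q, Subsingleton (Quiver.Costar x)) : IsRadSqZeroNakayama K Λ := by
  let φ : PathAlgebra K Q →ₐ[K] Λ :=
    e.symm.toAlgHom.comp ((arrowIdealPow K Q 2).ringCon.mkₐ K)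
  have hφ : Function.Surjective φ :=
    e.symm.surjective.comp (RingCon.mk'_surjective _)
  have hker (a : PathAlgebra K Q) (ha : φ a = 0) : a ∈ arrowIdealPow K Q 2 := by
    have h : (arrowIdealPow K Q 2).ringCon.mkₐ K a = 0 :=
      (map_eq_zero_iff e.symm e.symm.injective).1 ha
    exact (RingCon.eq _).1 h
  have hthin (x y : Q) : Subsingleton (x ⟶ y) := ⟨fun α β => by
    have : (⟨y, α⟩ : Quiver.Star x) = ⟨y, β⟩ := Subsingleton.elim _ _
    simpa using this⟩
  have : Nonempty Q := by
    by_contra h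
    rw [not_nonempty_iff] at h
    have h1 : (1 : PathAlgebra K Q) = 0 := by rw [one_def]; simp
    have := hΛ.1
    exact one_ne_zero (by rw [← map_one φ, h1, map_zero] : (1 : Λ) = 0)
  obtain ⟨n, σ, h⟩ := exists_enumeration (fun x y : Q => Nonempty (x ⟶ y))
    (fun x y y' ⟨α⟩ ⟨β⟩ => congrArg Sigma.fst
      (Subsingleton.elim (⟨y, α⟩ : Quiver.Star x) ⟨y', β⟩))
    (fun x x' y ⟨α⟩ ⟨β⟩ => congrArg Sigma.fst
      (Subsingleton.elim (⟨x, α⟩ : Quiver.Costar y) ⟨x', β⟩))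
    (eq_empty_or_univ_of_isConnectedRing hΛ φ hφ hker)
  rcases h with h | h
  · left
    obtain ⟨f⟩ := nonempty_radSqZeroPathAlgebra_algEquiv (K := K) (Q' := LinearQuiver (n + 1))
      σ.symm hthin (fun x y => inferInstanceAs (Subsingleton (PLift _))) fun x y => by
        have := h (σ.symm x) (σ.symm y)
        rw [σ.apply_symm_apply, σ.apply_symm_apply] at this
        exact this.trans ⟨fun h => ⟨PLift.up h⟩, fun ⟨h⟩ => PLift.down h⟩
    exact ⟨n + 1, Nat.le_add_left 1 n, ⟨e.trans f⟩⟩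
  · right
    obtain ⟨f⟩ := nonempty_radSqZeroPathAlgebra_algEquiv (K := K) (Q' := CyclicQuiver n)
      σ.symm hthin (fun x y => inferInstanceAs (Subsingleton (PLift _))) fun x y => by
        have := h (σ.symm x) (σ.symm y)
        rw [σ.apply_symm_apply, σ.apply_symm_apply] at this
        exact this.trans ⟨fun h => ⟨PLift.up h⟩, fun ⟨h⟩ => PLift.down h⟩
    exact ⟨n, ⟨e.trans f⟩⟩

end PathAlgebra

/-! ### Gentle presentations with vertex weights -/

namespace IsGentlePresentation

variable {K Q : Type*} [Field K] [Quiver Q] [Fintype Q] {I : TwoSidedIdeal (PathAlgebra K Q)}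

/-- All pairs of weights on arrows that agree along the relations come from weights on
vertices. -/
def HasVertexWeights (I : TwoSidedIdeal (PathAlgebra K Q)) : Prop :=
  ∀ F G : ∀ x y : Q, (x ⟶ y) → K,
    (∀ (x y z : Q) (α : x ⟶ y) (β : y ⟶ z), arrowMul K α β ∈ I → G y z β = F x y α) →
    ∃ c : Q → K, ∀ (x y : Q) (α : x ⟶ y), G x y α = c x ∧ F x y α = c y

-- With G the indicator of β and F the indicator of the arrows forming a relation with β, the vertex
-- weight at `v` is G(β) = 1. Every arrow leaving `v` then has G equal to 1 and every arrow entering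
-- `v` has F equal to 1.
open Classical in
theorem star_eq_and_arrowMul_mem (hI : IsGentlePresentation I) (hw : HasVertexWeights I)
    {v z : Q} (β : v ⟶ z) :
    (∀ β' : Quiver.Star v, β' = ⟨z, β⟩) ∧ ∀ (x : Q) (α : x ⟶ v), arrowMul K α β ∈ I := by
  let P (x y : Q) (α : x ⟶ y) : Prop :=
    ∃ β' : Quiver.Star y, (⟨y, β'⟩ : Σ y : Q, Quiver.Star y) = ⟨v, z, β⟩ ∧
      arrowMul K α β'.2 ∈ I
  obtain ⟨c, hc⟩ := hw (fun x y α => if P x y α then 1 else 0)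
    (fun x y α => if (⟨x, y, α⟩ : Σ y : Q, Quiver.Star y) = ⟨v, z, β⟩ then 1 else 0)
    (fun x y w α γ h => by
      refine if_congr ⟨fun e => ⟨⟨w, γ⟩, e, h⟩, ?_⟩ rfl rfl
      rintro ⟨β', e, h'⟩
      -- At most one arrow forms a relation after a given one, so γ must be β.
      rw [← e, hI.right_zero α (show (⟨w, γ⟩ : Quiver.Star y) ∈ _ from h)
        (show β' ∈ _ from h')])
  have hv : c v = 1 := by
    rw [← (hc v z β).1, if_pos rfl]
  constructor
  · rintro ⟨y, β'⟩
    have h1 := (hc v y β').1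
    rw [hv] at h1
    have h2 : (⟨v, y, β'⟩ : Σ y : Q, Quiver.Star y) = ⟨v, z, β⟩ := by
      by_contra h
      rw [if_neg h] at h1
      exact zero_ne_one h1
    exact eq_of_heq (Sigma.mk.inj h2).2
  · intro x α
    have h1 := (hc x v α).2
    rw [hv] at h1
    have h2 : P x v α := by
      by_contra h
      rw [if_neg h] at h1
      exact zero_ne_one h1
    obtain ⟨β', e, h⟩ := h2
    rwa [eq_of_heq (Sigma.mk.inj e).2] at h

theorem subsingleton_star (hI : IsGentlePresentation I) (hw : HasVertexWeights I) (v : Q) :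
    Subsingleton (Quiver.Star v) :=
  ⟨fun β β' => ((hI.star_eq_and_arrowMul_mem hw β'.2).1 β)⟩

open Classical in
theorem subsingleton_costar (hI : IsGentlePresentation I) (hw : HasVertexWeights I) (v : Q) :
    Subsingleton (Quiver.Costar v) := by
  refine ⟨fun α α' => ?_⟩
  by_cases hout : Nonempty (Quiver.Star v)
  · obtain ⟨z, β⟩ := hout
    have h := (hI.star_eq_and_arrowMul_mem hw β).2
    exact hI.left_zero β (h _ α.2) (h _ α'.2)
  · obtain ⟨c, hc⟩ := hw
      -- At a sink, F is the indicator of α and G is zero. These are compatible because no arrow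
      -- follows α, and F depends only on the target.
      (fun x y γ => if (⟨y, x, γ⟩ : Σ y : Q, Quiver.Costar y) = ⟨v, α⟩ then 1 else 0)
      (fun _ _ _ => 0) (fun x y z γ β _ => by
        rw [if_neg]
        intro h
        obtain rfl : y = v := congrArg Sigma.fst h
        exact hout ⟨⟨z, β⟩⟩)
    have h1 := (hc _ _ α.2).2
    have h2 := (hc _ _ α'.2).2
    rw [← h1, if_pos rfl] at h2
    have h3 : (⟨v, α'⟩ : Σ y : Q, Quiver.Costar y) = ⟨v, α⟩ := by
      by_contra h
      rw [if_neg h] at h2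
      exact zero_ne_one h2
    exact (eq_of_heq (Sigma.mk.inj h3).2).symm

/-- Every path of length two ends in some arrow β, and all compositions with β on the right are
relations. -/
theorem eq_arrowIdealPow_two (hI : IsGentlePresentation I) (hw : HasVertexWeights I) :
    I = PathAlgebra.arrowIdealPow K Q 2 := by
  refine le_antisymm hI.admissible.1 (TwoSidedIdeal.span_le.2 ?_)
  rintro _ ⟨x, y, p, hp, rfl⟩
  cases p with
  | nil => simp at hp
  | cons p β =>
    cases p with
    | nil => simp at hp
    | cons p α =>
      cases p with
      | nil => exact (hI.star_eq_and_arrowMul_mem hw β).2 _ α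
      | cons p γ => simp at hp

end IsGentlePresentation

end

theorem mainTheorem2 {K : Type u} [Field K] [IsAlgClosed K] {Λ : Type w} [Ring Λ] [Algebra K Λ]
    [Module.Finite K Λ] (hconn : IsConnectedRing Λ)
    (hgentle : IsGentleAlgebra.{u, w, uQ, vQ} K Λ)
    (hct : ∃ d : ℕ, 2 ≤ d ∧ HasDClusterTiltingSubcategory K Λ d) :
    IsRadSqZeroNakayama K Λ := by
  obtain ⟨Q, _, _, I, hI, ⟨e⟩⟩ := hgentle
  obtain ⟨d, hd, hct⟩ := hct
  have := isNoetherianRing_mulOpposite K Λ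
  let φ : PathAlgebra K Q →ₐ[K] Λ := e.symm.toAlgHom.comp (I.ringCon.mkₐ K)
  have hφ : Function.Surjective φ := e.symm.surjective.comp (RingCon.mk'_surjective _)
  have hker (a : PathAlgebra K Q) : φ a = 0 ↔ a ∈ I := by
    have h : φ a = 0 ↔ I.ringCon.mkₐ K a = 0 := map_eq_zero_iff e.symm e.symm.injective
    exact h.trans (RingCon.eq _)
  have hw : IsGentlePresentation.HasVertexWeights I :=
    exists_vertex_weight (hct.injProjExtensionsSplit hd) φ hφ hker hI.admissible.1 hI.generated
  obtain rfl := hI.eq_arrowIdealPow_two hw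
  exact PathAlgebra.isRadSqZeroNakayama_of_subsingleton_star hconn e (hI.subsingleton_star hw)
    (hI.subsingleton_costar hw)
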